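/- Setting. Let $d\le n$ and let $M_0\in\mathbb R^{n\times d}$ have rank $r$, entries bounded in absolute value by $L>0$, and singular value decomposition $M_0=U\Lambda V^T$ with $U^TU=V^TV=I_r$ and $\Lambda=\mathrm{diag}(\lambda_1,\dots,\lambda_r)$, $\lambda_1\ge\dots\ge\lambda_r>0$. The noise matrix $\epsilon\in\mathbb R^{n\times d}$ has i.i.d. entries with mean $0$ and variance $\sigma^2$ that are sub-Gaussian: $\mathbb E e^{t\epsilon_{kh}}\le e^{Kt^2/2}$ for all $t\in\mathbb R$. The mask $y\in\{0,1\}^{n\times d}$ has i.i.d. Bernoulli$(p)$ entries, $0<p\le 1$, and is independent of $\epsilon$. One observes $y$ and $M\in\mathbb R^{n\times d}$, $M_{kh}=y_{kh}\,(M_{0,kh}+\epsilon_{kh})$. Put $\hat p=\frac1{nd}\sum_{k,h}y_{kh}$, $$\hat\Sigma_{\hat p}=M^TM-(1-\hat p)\,\mathrm{diag}(M^TM),\qquad \hat\Sigma_{\hat p t}=MM^T-(1-\hat p)\,\mathrm{diag}(MM^T),$$ and let $\hat V\in\mathbb R^{d\times r}$ and $\hat U\in\mathbb R^{n\times r}$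 be (measurable choices of) matrices whose columns are orthonormal eigenvectors for the $r$ largest eigenvalues, in nonincreasing order, of $\hat\Sigma_{\hat p}$ and $\hat\Sigma_{\hat p t}$, respectively. The superscript $(m)$ denotes the first $m$ columns. For matrices $Z_1,Z_2$ with orthonormal columns, $\|\sin(Z_1,Z_2)\|_F^2=\|Z_1Z_1^T(I-Z_2Z_2^T)\|_F^2$. Assumption 1. (1) $\lambda_i=b_i\sqrt{nd}$ with $1/c\le b_i\le c$ for $i=1,\dots,r$, where $c>0$ is a constant; (2) for some $m\in\{1,\dots,r\}$, $b_m>b_{m+1}$, where $b_{r+1}=0$; (3) $d\le n\le e^{d^\alpha}$ for a constant $\alpha<1$. Theorem 1. There are constants $C_1,C_2>0$, depending only on $\alpha,L,c,\sigma,K$ (in particular free of $n$, $d$ and $p$), with the following property. For all $p_0>0$ and $\delta>0$ there is an $N$ such that, in the setting above and under Assumption 1, whenever $n,d\ge N$, $p_0\le p\le1$ and $b_m-b_{m+1}\ge\delta$, $$\mathbb E\big\|\sin\big(\hat V^{(m)},V^{(m)}\big)\big\|_F^2\le\frac{C_1\,n^{-1}}{p\,(b_m^2-b_{m+1}^2)^2}\qquad\text{and}\qquad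 \mathbb E\big\|\sin\big(\hat U^{(m)},U^{(m)}\big)\big\|_F^2\le\frac{C_2\,d^{-1}}{p\,(b_m^2-b_{m+1}^2)^2}.$$ -/

import Mathlib

open MeasureTheory ProbabilityTheory
open scoped Matrix NNReal

noncomputable section

namespace PartialObs

/-- `M₀ = U Λ Vᵀ` is a (thin, ordered) singular value decomposition of a matrix of rank `r`. -/
structure IsSVD {n d r : ℕ} (M₀ : Matrix (Fin n) (Fin d) ℝ) (U : Matrix (Fin n) (Fin r) ℝ)
    (lam : Fin r → ℝ) (V : Matrix (Fin d) (Fin r) ℝ) : Prop where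
  left_orthonormal : Uᵀ * U = 1
  right_orthonormal : Vᵀ * V = 1
  pos : ∀ i, 0 < lam i
  antitone : Antitone lam
  factor : M₀ = U * Matrix.diagonal lam * Vᵀ

/-- The sampling model: the entries of the noise `ε` are i.i.d. sub-Gaussian (with parameter `K`)
with mean zero and variance `σ ^ 2`; the entries of the mask `y` are i.i.d. Bernoulli(`p`);
and `y` is independent of `ε`. -/
structure IsModel {Ω : Type*} [MeasurableSpace Ω] (μ : Measure Ω) {n d : ℕ}
    (ε y : Ω → Matrix (Fin n) (Fin d) ℝ) (σ : ℝ) (K : ℝ≥0) (p : ℝ) : Prop where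
  noise_measurable : ∀ k h, Measurable (fun ω => ε ω k h)
  noise_indep : iIndepFun (fun (kh : Fin n × Fin d) (ω : Ω) => ε ω kh.1 kh.2) μ
  noise_identDistrib : ∀ k h k' h',
    IdentDistrib (fun ω => ε ω k h) (fun ω => ε ω k' h') μ μ
  noise_subgaussian : ∀ k h, HasSubgaussianMGF (fun ω => ε ω k h) K μ
  noise_mean : ∀ k h, ∫ ω, ε ω k h ∂μ = 0
  noise_variance : ∀ k h, variance (fun ω => ε ω k h) μ = σ ^ 2
  mask_measurable : ∀ k h, Measurable (fun ω => y ω k h)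
  mask_values : ∀ ω k h, y ω k h = 0 ∨ y ω k h = 1
  mask_prob : ∀ k h, μ.real {ω | y ω k h = 1} = p
  mask_indep : iIndepFun (fun (kh : Fin n × Fin d) (ω : Ω) => y ω kh.1 kh.2) μ
  indep : IndepFun (fun (ω : Ω) (kh : Fin n × Fin d) => ε ω kh.1 kh.2)
    (fun (ω : Ω) (kh : Fin n × Fin d) => y ω kh.1 kh.2) μ

/-- The partially observed matrix: `M₀ + ε` at the observed entries (`y = 1`), `0` elsewhere. -/
def observed {n d : ℕ} (M₀ ε y : Matrix (Fin n) (Fin d) ℝ) : Matrix (Fin n) (Fin d) ℝ :=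
  Matrix.of fun k h => y k h * (M₀ k h + ε k h)

/-- The proportion of observed entries. -/
def phat {n d : ℕ} (y : Matrix (Fin n) (Fin d) ℝ) : ℝ :=
  (∑ k, ∑ h, y k h) / ((n : ℝ) * (d : ℝ))

/-- The diagonal adjustment `S - (1 - q) diag(S)`. -/
def adjust {N : ℕ} (q : ℝ) (S : Matrix (Fin N) (Fin N) ℝ) : Matrix (Fin N) (Fin N) ℝ :=
  S - (1 - q) • Matrix.diagonal (fun i => S i i)

/-- The bias-adjusted Gram matrix `MᵀM - (1 - p̂) diag(MᵀM)`. -/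
def sigmaHat {n d : ℕ} (M y : Matrix (Fin n) (Fin d) ℝ) : Matrix (Fin d) (Fin d) ℝ :=
  adjust (phat y) (Mᵀ * M)

/-- The bias-adjusted Gram matrix `MMᵀ - (1 - p̂) diag(MMᵀ)`. -/
def sigmaHatT {n d : ℕ} (M y : Matrix (Fin n) (Fin d) ℝ) : Matrix (Fin n) (Fin n) ℝ :=
  adjust (phat y) (M * Mᵀ)

/-- `W` consists of the first `r` columns of the orthogonal matrix `Q` in some
eigendecomposition `A = Q diag(lam) Qᵀ` with eigenvalues in nonincreasing order. -/
def IsTopEigenvectors {N r : ℕ} (A : Matrix (Fin N) (Fin N) ℝ) (W : Matrix (Fin N) (Fin r) ℝ) :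
    Prop :=
  ∃ (hr : r ≤ N) (Q : Matrix (Fin N) (Fin N) ℝ) (lam : Fin N → ℝ),
    Qᵀ * Q = 1 ∧ Antitone lam ∧ A = Q * Matrix.diagonal lam * Qᵀ ∧
    W = Q.submatrix id (Fin.castLE hr)

/-- The first `m` columns of a matrix. -/
def firstCols {N r : ℕ} (W : Matrix (Fin N) (Fin r) ℝ) (m : ℕ) (hm : m ≤ r) :
    Matrix (Fin N) (Fin m) ℝ :=
  W.submatrix id (Fin.castLE hm)

/-- Squared Frobenius norm `tr(AᵀA)`. -/
def frobSq {m n : ℕ} (A : Matrix (Fin m) (Fin n) ℝ) : ℝ := (Aᵀ * A).trace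

/-- `‖sin(Z₁, Z₂)‖_F² = ‖P₁ (I - P₂)‖_F²` for matrices with orthonormal columns, whose column
spaces have orthogonal projections `Pᵢ = Zᵢ Zᵢᵀ`: the sum of the squares of the sines of the
canonical angles between the two column spaces. -/
def sinDistSq {N m : ℕ} (Z₁ Z₂ : Matrix (Fin N) (Fin m) ℝ) : ℝ :=
  frobSq ((Z₁ * Z₁ᵀ) * (1 - Z₂ * Z₂ᵀ))

end PartialObs

end

/-!
Write `Σ̂` for the adjusted Gram matrix and `Σ = p² (M₀ᵀM₀ + n σ² I)` for its idealised version. The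
leading eigenvectors of `Σ` are the leading right singular vectors of `M₀`, with eigenvalue gap
`g = p² n d (b_m² - b_{m+1}²)`, and `D = Σ̂ - Σ` is centred off the diagonal.

*Perturbation.* Let `P` and `Q` be the projections onto the leading `m` eigenvectors of `Σ` and of
`Σ̂`, and let `s² = ‖sin‖²`. Since `Σ` loses at least `g s²` on passing from `P` to `Q`
(`gap_mul_sinDistSq_le`) while `Q` is optimal for `Σ̂` (`IsTopEigenvectors.trace_le`), one gets
`g s² ≤ tr (D (Q - P))`. Splitting `Q - P` into blocks bounds the right-hand side by
`2 ‖D P‖ s + ‖D‖ s²` in Frobenius norm (`trace_mul_proj_sub_le`). Hence `s² ≤ 16 ‖D P‖² / g²` as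
soon as `‖D‖ ≤ g / 2`, and `s² ≤ m` always.

*Probability.* Only the size of `D P` decides the rate. For a unit vector `v`, the `h`-th coordinate
of the off-diagonal part of `D v` is a centred sum over the `n` independent rows, with terms
`M_kh ∑_{j ≠ h} M_kj v_j` whose two factors are independent. The first has second moment `O(p)` and
the second `O(p + p² d)`, so the total over coordinates is `O(p³ n d²)` once `p d ≥ 1`
(`integral_gram_mulVec_sq_le`); division by `g²` gives the rate `1 / (n p (b_m² - b_{m+1}²)²)`. The
diagonal part of `D` has `E ‖·‖² = O(n d)` (`IsModel.integral_diagError_sq_le`), which is of lower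
order because `p ≥ p₀`. The event `‖D‖ > g / 2` is controlled by a fourth moment for the
off-diagonal part: `E ‖·‖⁴ = O(n² d⁴)`, so that its contribution is `O(n⁻²)` for fixed `p₀` and `δ`.

The rank is at most `c² L²` because every singular value carries a fixed share of `‖M₀‖²`. No
relation between `n` and `d` is needed, so the statement for left singular vectors follows by
transposing the data.
-/

namespace PartialObs

/-! ### The Frobenius norm -/

lemma frobSq_eq_sum {m n : ℕ} (A : Matrix (Fin m) (Fin n) ℝ) :
    frobSq A = ∑ j, ∑ i, A i j ^ 2 := by
  simp [frobSq, Matrix.trace, Matrix.mul_apply, sq]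

lemma frobSq_nonneg {m n : ℕ} (A : Matrix (Fin m) (Fin n) ℝ) : 0 ≤ frobSq A := by
  rw [frobSq_eq_sum]; positivity

lemma frobSq_transpose {m n : ℕ} (A : Matrix (Fin m) (Fin n) ℝ) : frobSq Aᵀ = frobSq A := by
  rw [frobSq_eq_sum, frobSq_eq_sum, Finset.sum_comm]
  rfl

lemma trace_transpose_mul_eq_sum {m n : ℕ} (A B : Matrix (Fin m) (Fin n) ℝ) :
    (Aᵀ * B).trace = ∑ j, ∑ i, A i j * B i j := by
  simp [Matrix.trace, Matrix.mul_apply]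

/-- Cauchy–Schwarz for the Frobenius inner product. -/
lemma trace_transpose_mul_le {m n : ℕ} (A B : Matrix (Fin m) (Fin n) ℝ) :
    (Aᵀ * B).trace ≤ √(frobSq A) * √(frobSq B) := by
  rw [trace_transpose_mul_eq_sum, frobSq_eq_sum, frobSq_eq_sum]
  simp_rw [← Fintype.sum_prod_type']
  exact Real.sum_mul_le_sqrt_mul_sqrt _ _ _

lemma frobSq_mul_le {l m n : ℕ} (A : Matrix (Fin l) (Fin m) ℝ) (B : Matrix (Fin m) (Fin n) ℝ) :
    frobSq (A * B) ≤ frobSq A * frobSq B := by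
  rw [← frobSq_transpose A, frobSq_eq_sum, frobSq_eq_sum Aᵀ, frobSq_eq_sum B, Finset.mul_sum]
  refine Finset.sum_le_sum fun j _ => ?_
  rw [Finset.sum_mul]
  refine Finset.sum_le_sum fun i _ => ?_
  rw [Matrix.mul_apply]
  exact Finset.sum_mul_sq_le_sq_mul_sq _ _ _

lemma frobSq_add_le {m n : ℕ} (A B : Matrix (Fin m) (Fin n) ℝ) :
    frobSq (A + B) ≤ 2 * frobSq A + 2 * frobSq B := by
  simp only [frobSq_eq_sum, Finset.mul_sum, ← Finset.sum_add_distrib]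
  refine Finset.sum_le_sum fun j _ => Finset.sum_le_sum fun i _ => ?_
  rw [Matrix.add_apply]
  nlinarith [sq_nonneg (A i j - B i j)]

lemma one_sub_idempotent {m : ℕ} {P : Matrix (Fin m) (Fin m) ℝ} (hP2 : P * P = P) :
    (1 - P) * (1 - P) = 1 - P := by
  rw [sub_mul, mul_sub, mul_sub, hP2]; simp

/-- Multiplying by an orthogonal projection does not increase the Frobenius norm. -/
lemma frobSq_proj_mul_le {m n : ℕ} {P : Matrix (Fin m) (Fin m) ℝ} (hP : Pᵀ = P) (hP2 : P * P = P)
    (A : Matrix (Fin m) (Fin n) ℝ) : frobSq (P * A) ≤ frobSq A := by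
  have h1 : frobSq A = frobSq (P * A) + frobSq ((1 - P) * A) := by
    have hc := one_sub_idempotent hP2
    unfold frobSq
    rw [← Matrix.trace_add, Matrix.transpose_mul, Matrix.transpose_mul, Matrix.transpose_sub, hP,
      Matrix.transpose_one]
    have e1 : Aᵀ * P * (P * A) = Aᵀ * P * A := by
      rw [Matrix.mul_assoc, ← Matrix.mul_assoc P, hP2, Matrix.mul_assoc]
    have e2 : Aᵀ * (1 - P) * ((1 - P) * A) = Aᵀ * (1 - P) * A := by
      rw [Matrix.mul_assoc, ← Matrix.mul_assoc (1 - P), hc, Matrix.mul_assoc]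
    rw [e1, e2, ← Matrix.add_mul, ← Matrix.mul_add]
    simp
  linarith [frobSq_nonneg ((1 - P) * A)]

/-! ### Orthogonal projections and canonical angles -/

section Projection

variable {N m r : ℕ} {Z W : Matrix (Fin N) (Fin m) ℝ}

lemma proj_transpose (Z : Matrix (Fin N) (Fin m) ℝ) : (Z * Zᵀ)ᵀ = Z * Zᵀ := by simp

lemma proj_idempotent (hZ : Zᵀ * Z = 1) : (Z * Zᵀ) * (Z * Zᵀ) = Z * Zᵀ := by
  rw [Matrix.mul_assoc, ← Matrix.mul_assoc Zᵀ, hZ, Matrix.one_mul]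

lemma trace_proj (hZ : Zᵀ * Z = 1) : (Z * Zᵀ).trace = m := by
  rw [Matrix.trace_mul_comm, hZ]; simp

lemma frobSq_of_orthonormal (hZ : Zᵀ * Z = 1) : frobSq Z = m := by
  simp [frobSq, hZ]

lemma frobSq_proj_mul_one_sub {P Q : Matrix (Fin N) (Fin N) ℝ} (hP : Pᵀ = P) (hP2 : P * P = P)
    (hQ : Qᵀ = Q) (hQ2 : Q * Q = Q) : frobSq (Q * (1 - P)) = Q.trace - (P * Q).trace := by
  unfold frobSq
  rw [Matrix.transpose_mul, hQ, Matrix.transpose_sub, hP, Matrix.transpose_one,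
    Matrix.mul_assoc, ← Matrix.mul_assoc Q, hQ2, Matrix.trace_mul_comm, Matrix.mul_assoc,
    one_sub_idempotent hP2, Matrix.mul_sub, Matrix.trace_sub, Matrix.mul_one,
    Matrix.trace_mul_comm Q P]

lemma sinDistSq_eq (hZ : Zᵀ * Z = 1) (hW : Wᵀ * W = 1) :
    sinDistSq W Z = m - ((Z * Zᵀ) * (W * Wᵀ)).trace := by
  rw [sinDistSq, frobSq_proj_mul_one_sub (proj_transpose Z) (proj_idempotent hZ)
    (proj_transpose W) (proj_idempotent hW), trace_proj hW]

lemma trace_proj_mul_proj_nonneg (hZ : Zᵀ * Z = 1) (W : Matrix (Fin N) (Fin r) ℝ)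
    (hW : Wᵀ * W = 1) : 0 ≤ ((Z * Zᵀ) * (W * Wᵀ)).trace := by
  have h := frobSq_nonneg ((W * Wᵀ) * (Z * Zᵀ))
  unfold frobSq at h
  rwa [Matrix.transpose_mul, proj_transpose, proj_transpose, Matrix.mul_assoc,
    ← Matrix.mul_assoc (W * Wᵀ), proj_idempotent hW, Matrix.trace_mul_comm, Matrix.mul_assoc,
    proj_idempotent hZ, Matrix.trace_mul_comm] at h

lemma sinDistSq_nonneg (W Z : Matrix (Fin N) (Fin m) ℝ) : 0 ≤ sinDistSq W Z := frobSq_nonneg _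

lemma sinDistSq_le (hZ : Zᵀ * Z = 1) (hW : Wᵀ * W = 1) : sinDistSq W Z ≤ m := by
  rw [sinDistSq_eq hZ hW]
  linarith [trace_proj_mul_proj_nonneg hZ W hW]

/-- The perturbation term of the variational inequality. Writing `P = ZZᵀ` and `Q = WWᵀ`, the
three blocks of `Q - P` that touch the range of `P` have size `‖sin(W, Z)‖` and only see `D Z`;
the remaining block `(1 - P) Q (1 - P)` has size `‖sin(W, Z)‖²`. -/
lemma trace_mul_proj_sub_le (hZ : Zᵀ * Z = 1) (hW : Wᵀ * W = 1) {D : Matrix (Fin N) (Fin N) ℝ}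
    (hD : Dᵀ = D) :
    (D * (W * Wᵀ - Z * Zᵀ)).trace ≤
      2 * (√(frobSq (D * Z)) * √(sinDistSq W Z)) + √(frobSq D) * sinDistSq W Z := by
  set P := Z * Zᵀ with hPdef
  set Q := W * Wᵀ with hQdef
  have hP : Pᵀ = P := proj_transpose Z
  have hQ : Qᵀ = Q := proj_transpose W
  have hP2 : P * P = P := proj_idempotent hZ
  have hQ2 : Q * Q = Q := proj_idempotent hW
  have hs : frobSq (Q * (1 - P)) = sinDistSq W Z := rfl
  have hs' : frobSq ((Q - P) * P) = sinDistSq W Z := by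
    have e : (Q - P) * P = -((1 - Q) * P) := by
      rw [Matrix.sub_mul, Matrix.sub_mul, hP2]; simp
    have e2 : frobSq ((Q - P) * P) = frobSq (P * (1 - Q)) := by
      rw [e, ← frobSq_transpose, Matrix.transpose_neg, Matrix.transpose_mul, hP,
        Matrix.transpose_sub, hQ, Matrix.transpose_one]
      simp [frobSq]
    rw [e2, frobSq_proj_mul_one_sub hQ hQ2 hP hP2, sinDistSq_eq hZ hW, ← hPdef, ← hQdef,
      trace_proj hZ, Matrix.trace_mul_comm]
  have hDZ : frobSq (D * P) = frobSq (D * Z) := by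
    have e : (D * P)ᵀ * (D * P) = Z * ((D * Z)ᵀ * (D * Z) * Zᵀ) := by
      rw [hPdef]; simp only [Matrix.transpose_mul, Matrix.transpose_transpose, Matrix.mul_assoc]
    unfold frobSq
    rw [e, Matrix.trace_mul_comm, Matrix.mul_assoc, hZ, Matrix.mul_one]
  have split : (D * (Q - P)).trace = ((D * P)ᵀ * ((Q - P) * P)).trace
      + ((D * P)ᵀ * ((1 - P) * ((Q - P) * P))).trace
      + (Dᵀ * ((Q * (1 - P))ᵀ * (Q * (1 - P)))).trace := by
    have t1 : ((D * P)ᵀ * ((Q - P) * P)).trace = (D * (P * (Q - P))).trace := by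
      rw [← Matrix.trace_transpose (D * _)]
      simp only [Matrix.transpose_mul, Matrix.transpose_sub, hP, hQ, hD]
      rw [Matrix.trace_mul_comm, Matrix.mul_assoc, ← Matrix.mul_assoc P P, hP2, ← Matrix.mul_assoc]
    have t2 : ((D * P)ᵀ * ((1 - P) * ((Q - P) * P))).trace
        = (D * ((1 - P) * ((Q - P) * P))).trace := by
      rw [Matrix.transpose_mul, hP, hD, Matrix.mul_assoc P, Matrix.trace_mul_comm]
      simp only [Matrix.mul_assoc, hP2]
    have t3 : (Q * (1 - P))ᵀ * (Q * (1 - P)) = (1 - P) * ((Q - P) * (1 - P)) := by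
      have e : P * (1 - P) = 0 := by rw [Matrix.mul_sub, hP2]; simp
      rw [Matrix.transpose_mul, Matrix.transpose_sub, hP, hQ, Matrix.transpose_one,
        Matrix.mul_assoc, ← Matrix.mul_assoc Q, hQ2, Matrix.sub_mul Q, e, sub_zero]
    rw [t1, t2, t3, hD, ← Matrix.trace_add, ← Matrix.trace_add, ← Matrix.mul_add, ← Matrix.mul_add]
    congr 2
    noncomm_ring
  have b1 := trace_transpose_mul_le (D * P) ((Q - P) * P)
  have b2 := trace_transpose_mul_le (D * P) ((1 - P) * ((Q - P) * P))
  have b3 := trace_transpose_mul_le D ((Q * (1 - P))ᵀ * (Q * (1 - P)))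
  have c2 : frobSq ((1 - P) * ((Q - P) * P)) ≤ sinDistSq W Z := by
    rw [← hs']
    exact frobSq_proj_mul_le (by simp [hP]) (one_sub_idempotent hP2) _
  have c3 : √(frobSq ((Q * (1 - P))ᵀ * (Q * (1 - P)))) ≤ sinDistSq W Z := by
    rw [Real.sqrt_le_left (sinDistSq_nonneg W Z)]
    calc _ ≤ _ := frobSq_mul_le _ _
      _ = _ := by rw [frobSq_transpose, hs, sq]
  rw [hs', hDZ] at b1
  rw [hDZ] at b2
  have b2' := b2.trans (mul_le_mul_of_nonneg_left (Real.sqrt_le_sqrt c2) (Real.sqrt_nonneg _))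
  have b3' := b3.trans (mul_le_mul_of_nonneg_left c3 (Real.sqrt_nonneg _))
  rw [split]
  linarith

/-- A Davis–Kahan bound in which the perturbation enters only through its action on the range of
the unperturbed projection, provided the whole perturbation is at most half the gap. -/
lemma sinDistSq_le_of_gap (hZ : Zᵀ * Z = 1) (hW : Wᵀ * W = 1) {D : Matrix (Fin N) (Fin N) ℝ}
    (hD : Dᵀ = D) {g : ℝ} (hg : 0 < g)
    (hgap : g * sinDistSq W Z ≤ (D * (W * Wᵀ - Z * Zᵀ)).trace)
    (hsmall : frobSq D ≤ (g / 2) ^ 2) :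
    sinDistSq W Z ≤ 16 * frobSq (D * Z) / g ^ 2 := by
  have h := hgap.trans (trace_mul_proj_sub_le hZ hW hD)
  have hf : √(frobSq D) ≤ g / 2 := by
    rw [Real.sqrt_le_left (by positivity)]; exact hsmall
  have hs0 := sinDistSq_nonneg W Z
  obtain ⟨s, hs, hs2⟩ : ∃ s, 0 ≤ s ∧ s ^ 2 = sinDistSq W Z :=
    ⟨√(sinDistSq W Z), Real.sqrt_nonneg _, Real.sq_sqrt hs0⟩
  obtain ⟨a, ha, ha2⟩ : ∃ a, 0 ≤ a ∧ a ^ 2 = frobSq (D * Z) :=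
    ⟨√(frobSq (D * Z)), Real.sqrt_nonneg _, Real.sq_sqrt (frobSq_nonneg _)⟩
  rw [← hs2, ← ha2, Real.sqrt_sq hs, Real.sqrt_sq ha] at h
  have h1 : g * s * s ≤ 4 * a * s := by nlinarith [mul_le_mul_of_nonneg_right hf (sq_nonneg s)]
  have h2 : g * s ≤ 4 * a := by
    rcases hs.eq_or_lt with h0 | h0
    · rw [← h0]; linarith
    · exact le_of_mul_le_mul_right h1 h0
  rw [← hs2, ← ha2, le_div_iff₀ (by positivity)]
  nlinarith [mul_self_le_mul_self (by positivity) h2]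

end Projection

/-! ### Variational characterisation of leading eigenspaces -/

lemma sum_ite_lt {m r : ℕ} (hm : m ≤ r) (f : Fin r → ℝ) :
    ∑ i : Fin r, (if (i : ℕ) < m then f i else 0) = ∑ j : Fin m, f (Fin.castLE hm j) := by
  obtain ⟨k, rfl⟩ := Nat.exists_eq_add_of_le hm
  rw [Fin.sum_univ_add]
  simp
  rfl

section Variational

variable {N m r : ℕ}

lemma firstCols_orthonormal {Q : Matrix (Fin N) (Fin r) ℝ} (hQ : Qᵀ * Q = 1) (hm : m ≤ r) :
    (firstCols Q m hm)ᵀ * firstCols Q m hm = 1 := by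
  have : (firstCols Q m hm)ᵀ * firstCols Q m hm
      = (Qᵀ * Q).submatrix (Fin.castLE hm) (Fin.castLE hm) := rfl
  rw [this, hQ]
  exact Matrix.submatrix_one _ (Fin.castLE_injective hm)

lemma trace_mul_firstCols (A : Matrix (Fin N) (Fin N) ℝ) (Q : Matrix (Fin N) (Fin r) ℝ)
    (hm : m ≤ r) : (A * (firstCols Q m hm * (firstCols Q m hm)ᵀ)).trace
      = ∑ i : Fin r, if (i : ℕ) < m then (Qᵀ * A * Q) i i else 0 := by
  rw [sum_ite_lt hm (fun i => (Qᵀ * A * Q) i i), ← Matrix.mul_assoc, Matrix.trace_mul_comm,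
    ← Matrix.mul_assoc]
  rfl

/-- If the spectral weights `l` of `A = Q diag(l) Qᵀ` are at least `a` on the first `m`
eigenvectors and at most `b` on the others, then no rank-`m` projection captures more of `A` than
the leading one, and the loss grows at least like `(a - b) ‖sin‖²`. Off the range of `Q` the
matrix vanishes, so `0 ≤ b` is needed unless `Q` is square. -/
lemma gap_mul_sinDistSq_le {Q : Matrix (Fin N) (Fin r) ℝ} (hQ : Qᵀ * Q = 1) (hm : m ≤ r)
    {W : Matrix (Fin N) (Fin m) ℝ} (hW : Wᵀ * W = 1) {l : Fin r → ℝ} {a b : ℝ}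
    (ha : ∀ i : Fin r, (i : ℕ) < m → a ≤ l i) (hb : ∀ i : Fin r, m ≤ (i : ℕ) → l i ≤ b)
    (hb0 : 0 ≤ b ∨ r = N) :
    (a - b) * sinDistSq W (firstCols Q m hm) ≤
      ((Q * Matrix.diagonal l * Qᵀ) *
        (firstCols Q m hm * (firstCols Q m hm)ᵀ - W * Wᵀ)).trace := by
  set P := W * Wᵀ with hPdef
  have hP : Pᵀ = P := proj_transpose W
  have hP2 : P * P = P := proj_idempotent hW
  set w : Fin r → ℝ := fun i => (Qᵀ * P * Q) i i with hw
  have hw0 : ∀ i, 0 ≤ w i := fun i => by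
    have e : Qᵀ * P * Q = (Wᵀ * Q)ᵀ * (Wᵀ * Q) := by
      rw [hPdef]; simp only [Matrix.transpose_mul, Matrix.transpose_transpose, Matrix.mul_assoc]
    simp only [hw, e, Matrix.mul_apply (M := (Wᵀ * Q)ᵀ), Matrix.transpose_apply]
    exact Finset.sum_nonneg fun _ _ => mul_self_nonneg _
  have hw1 : ∀ i, w i ≤ 1 := fun i => by
    have e : Qᵀ * P * Q = 1 - ((1 - P) * Q)ᵀ * ((1 - P) * Q) := by
      rw [Matrix.transpose_mul, Matrix.transpose_sub, hP, Matrix.transpose_one,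
        Matrix.mul_assoc Qᵀ (1 - P), ← Matrix.mul_assoc (1 - P), one_sub_idempotent hP2,
        Matrix.sub_mul, Matrix.mul_sub, Matrix.one_mul, hQ, Matrix.mul_assoc]
      simp
    simp only [hw, e, Matrix.mul_apply (M := ((1 - P) * Q)ᵀ), Matrix.transpose_apply,
      Matrix.sub_apply, Matrix.one_apply_eq]
    exact sub_le_self _ (Finset.sum_nonneg fun _ _ => mul_self_nonneg _)
  have hsum : ∑ i, w i = (P * (Q * Qᵀ)).trace := by
    rw [← Matrix.mul_assoc, Matrix.trace_mul_comm, ← Matrix.mul_assoc]; rfl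
  have hb' : 0 ≤ b * ((m : ℝ) - ∑ i, w i) := by
    rcases hb0 with h | h
    · refine mul_nonneg h ?_
      have := frobSq_proj_mul_one_sub (proj_transpose Q) (proj_idempotent hQ) hP hP2
      rw [trace_proj hW, Matrix.trace_mul_comm] at this
      rw [hsum, ← this]
      exact frobSq_nonneg _
    · subst h
      rw [hsum, mul_eq_one_comm.mp hQ, Matrix.mul_one, trace_proj hW]
      simp
  have hcount : ∑ i : Fin r, (if (i : ℕ) < m then (1 : ℝ) else 0) = m := by
    rw [sum_ite_lt hm (fun _ => (1 : ℝ))]; simp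
  have hsin : sinDistSq W (firstCols Q m hm)
      = ∑ i : Fin r, if (i : ℕ) < m then 1 - w i else 0 := by
    rw [sinDistSq_eq (firstCols_orthonormal hQ hm) hW, Matrix.trace_mul_comm,
      trace_mul_firstCols, ← hcount, ← Finset.sum_sub_distrib]
    refine Finset.sum_congr rfl fun i _ => ?_
    split_ifs <;> simp [hw, hPdef]
  have hA : Qᵀ * (Q * Matrix.diagonal l * Qᵀ) * Q = Matrix.diagonal l := by
    rw [Matrix.mul_assoc Q, ← Matrix.mul_assoc, hQ, Matrix.one_mul, Matrix.mul_assoc, hQ,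
      Matrix.mul_one]
  have hAP : ((Q * Matrix.diagonal l * Qᵀ) * P).trace = ∑ i, l i * w i := by
    rw [Matrix.mul_assoc, Matrix.mul_assoc, Matrix.trace_mul_comm, Matrix.mul_assoc,
      Matrix.trace]
    simp [Matrix.diag_apply, Matrix.diagonal_mul, hw]
  rw [Matrix.mul_sub, Matrix.trace_sub, trace_mul_firstCols, hA, hAP, hsin]
  calc _ ≤ (a - b) * (∑ i : Fin r, if (i : ℕ) < m then 1 - w i else 0)
        + b * ((m : ℝ) - ∑ i, w i) := le_add_of_nonneg_right hb'
    _ ≤ _ := by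
      rw [← hcount, ← Finset.sum_sub_distrib, Finset.mul_sum, Finset.mul_sum,
        ← Finset.sum_add_distrib, ← Finset.sum_sub_distrib]
      refine Finset.sum_le_sum fun i _ => ?_
      split_ifs with h
      · rw [Matrix.diagonal_apply_eq]
        nlinarith [mul_le_mul_of_nonneg_right (ha i h) (sub_nonneg.2 (hw1 i))]
      · nlinarith [mul_le_mul_of_nonneg_right (hb i (not_lt.1 h)) (hw0 i)]

lemma IsTopEigenvectors.orthonormal {A : Matrix (Fin N) (Fin N) ℝ} {W : Matrix (Fin N) (Fin r) ℝ}
    (h : IsTopEigenvectors A W) : Wᵀ * W = 1 := by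
  obtain ⟨hr, Q, lam, hQ, -, -, rfl⟩ := h
  exact firstCols_orthonormal hQ hr

lemma IsTopEigenvectors.transpose_eq {A : Matrix (Fin N) (Fin N) ℝ}
    {W : Matrix (Fin N) (Fin r) ℝ} (h : IsTopEigenvectors A W) : Aᵀ = A := by
  obtain ⟨hr, Q, lam, -, -, rfl, -⟩ := h
  simp [Matrix.mul_assoc]

/-- Ky Fan's principle: the leading eigenvectors maximise `tr(A P)` over rank-`m` projections. -/
lemma IsTopEigenvectors.trace_le {A : Matrix (Fin N) (Fin N) ℝ} {W : Matrix (Fin N) (Fin r) ℝ}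
    (h : IsTopEigenvectors A W) (hm : m ≤ r) (h1 : 1 ≤ m) {Z : Matrix (Fin N) (Fin m) ℝ}
    (hZ : Zᵀ * Z = 1) :
    0 ≤ (A * (firstCols W m hm * (firstCols W m hm)ᵀ - Z * Zᵀ)).trace := by
  obtain ⟨hr, Q, lam, hQ, hlam, rfl, rfl⟩ := h
  have := gap_mul_sinDistSq_le hQ (hm.trans hr) hZ (l := lam) (a := lam ⟨m - 1, by omega⟩)
    (b := lam ⟨m - 1, by omega⟩) (fun i hi => hlam (Fin.mk_le_mk.2 (by omega)))
    (fun i hi => hlam (Fin.mk_le_mk.2 (by omega))) (Or.inr rfl)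
  rw [sub_self, zero_mul] at this
  exact this

/-- Deterministic perturbation bound. The target matrix is `V diag(l) Vᵀ + κ I`, and the shift
`κ I` plays no role because both projections have the same rank. -/
lemma IsTopEigenvectors.sinDistSq_le {A : Matrix (Fin N) (Fin N) ℝ}
    {W V : Matrix (Fin N) (Fin r) ℝ} (h : IsTopEigenvectors A W) (hV : Vᵀ * V = 1)
    (hm : m ≤ r) (h1 : 1 ≤ m) {l : Fin r → ℝ} {a b κ : ℝ}
    (ha : ∀ i : Fin r, (i : ℕ) < m → a ≤ l i) (hb : ∀ i : Fin r, m ≤ (i : ℕ) → l i ≤ b)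
    (hb0 : 0 ≤ b) (hab : b < a) {D : Matrix (Fin N) (Fin N) ℝ}
    (hD : A = V * Matrix.diagonal l * Vᵀ + κ • 1 + D) (hsmall : frobSq D ≤ ((a - b) / 2) ^ 2) :
    sinDistSq (firstCols W m hm) (firstCols V m hm)
      ≤ 16 * frobSq (D * firstCols V m hm) / (a - b) ^ 2 := by
  have hW' := firstCols_orthonormal h.orthonormal hm
  have hV' := firstCols_orthonormal hV hm
  have hDt : Dᵀ = D := by
    have h2 := h.transpose_eq
    rw [hD] at h2
    simpa [Matrix.mul_assoc] using h2
  refine sinDistSq_le_of_gap hV' hW' hDt (sub_pos.2 hab) ?_ hsmall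
  have g1 := gap_mul_sinDistSq_le hV hm hW' ha hb (Or.inl hb0)
  have g2 := h.trace_le hm h1 hV'
  rw [hD, Matrix.add_mul, Matrix.add_mul, Matrix.trace_add, Matrix.trace_add, Matrix.smul_mul,
    Matrix.one_mul, Matrix.trace_smul, Matrix.trace_sub _ (firstCols V m hm * _), trace_proj hW',
    trace_proj hV', sub_self, smul_zero, add_zero] at g2
  rw [← neg_sub (firstCols W m hm * _), Matrix.mul_neg, Matrix.trace_neg] at g1
  linarith

end Variational

/-! ### Moments and independence -/

section Moments

variable {Ω : Type*} [MeasurableSpace Ω] {μ : Measure Ω}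

/-- `X` belongs to every `Lᵠ(μ)` with `q < ∞`. This class is closed under sums and products, which
makes all integrability conditions on polynomials in the data automatic. -/
def AllMoments (X : Ω → ℝ) (μ : Measure Ω) : Prop := ∀ q : ℝ≥0, MemLp X q μ

namespace AllMoments

variable {X Y : Ω → ℝ}

lemma mul (hX : AllMoments X μ) (hY : AllMoments Y μ) : AllMoments (fun ω => X ω * Y ω) μ := by
  intro q
  have : ENNReal.HolderTriple ((2 * q : ℝ≥0) : ENNReal) ((2 * q : ℝ≥0) : ENNReal) q := by
    constructor
    rcases eq_or_ne q 0 with rfl | hq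
    · simp
    · rw [← ENNReal.coe_inv (by positivity), ← ENNReal.coe_inv hq, ← ENNReal.coe_add]
      congr 1
      field_simp
      norm_num
  exact (hY (2 * q)).mul' (hX (2 * q))

lemma add (hX : AllMoments X μ) (hY : AllMoments Y μ) : AllMoments (fun ω => X ω + Y ω) μ :=
  fun q => (hX q).add (hY q)

lemma sub (hX : AllMoments X μ) (hY : AllMoments Y μ) : AllMoments (fun ω => X ω - Y ω) μ :=
  fun q => (hX q).sub (hY q)

lemma const [IsFiniteMeasure μ] (c : ℝ) : AllMoments (fun _ => c) μ := fun _ => memLp_const c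

lemma sum {ι : Type*} (s : Finset ι) {X : ι → Ω → ℝ} (hX : ∀ i ∈ s, AllMoments (X i) μ) :
    AllMoments (fun ω => ∑ i ∈ s, X i ω) μ :=
  fun q => memLp_finsetSum s fun i hi => hX i hi q

lemma pow [IsFiniteMeasure μ] (hX : AllMoments X μ) (k : ℕ) : AllMoments (fun ω => X ω ^ k) μ := by
  induction k with
  | zero => simpa using const (μ := μ) 1
  | succ k ih => simpa only [pow_succ] using ih.mul hX

lemma integrable (hX : AllMoments X μ) : Integrable X μ :=
  memLp_one_iff_integrable.1 (by exact_mod_cast hX 1)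

lemma memLp_two (hX : AllMoments X μ) : MemLp X 2 μ := by exact_mod_cast hX 2

end AllMoments

/-- Functions of disjoint groups of independent variables are independent. -/
lemma indepFun_of_dependsOn {ι : Type*} {Z : ι → Ω → ℝ} (hZ : iIndepFun Z μ)
    (hm : ∀ i, Measurable (Z i)) {S T : Finset ι} (hST : Disjoint S T) {F G : (ι → ℝ) → ℝ}
    (hF : Measurable F) (hG : Measurable G) (hFS : DependsOn F (S : Set ι))
    (hGT : DependsOn G (T : Set ι)) :
    IndepFun (fun ω => F fun i => Z i ω) (fun ω => G fun i => Z i ω) μ := by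
  classical
  have key : ∀ (R : Finset ι) (H : (ι → ℝ) → ℝ), Measurable H → DependsOn H (R : Set ι) →
      ∃ φ : (R → ℝ) → ℝ, Measurable φ ∧ ∀ ω, H (fun i => Z i ω) = φ (fun i => Z i ω) := by
    intro R H hH hR
    refine ⟨fun u => H fun i => if h : i ∈ R then u ⟨i, h⟩ else 0, hH.comp ?_, fun ω => ?_⟩
    · refine measurable_pi_lambda _ fun i => ?_
      by_cases h : i ∈ R
      · simpa [h] using measurable_pi_apply _
      · simp [h]
    · exact hR fun i hi => by simp [Finset.mem_coe.1 hi]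
  obtain ⟨φ, hφ, eφ⟩ := key S F hF hFS
  obtain ⟨ψ, hψ, eψ⟩ := key T G hG hGT
  simp_rw [eφ, eψ]
  exact (hZ.indepFun_finset S T hST hm).comp hφ hψ

lemma integral_sub_mean_sq_eq_variance {X : Ω → ℝ} (hX : AllMoments X μ) :
    ∫ ω, (X ω - ∫ ω', X ω' ∂μ) ^ 2 ∂μ = variance X μ :=
  (variance_eq_integral hX.integrable.aemeasurable).symm

variable [IsProbabilityMeasure μ]

lemma integral_sq_le_of_integral_pow_four_le {X : Ω → ℝ} (hX : AllMoments X μ) {b : ℝ}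
    (hb : 0 < b) (h : ∫ ω, X ω ^ 4 ∂μ ≤ b ^ 2) : ∫ ω, X ω ^ 2 ∂μ ≤ b := by
  -- the tangent line of `t ↦ t²` at `t = b`, evaluated at `t = X²`
  have h1 : ∫ ω, (2 * b * X ω ^ 2 - b ^ 2) ∂μ ≤ ∫ ω, X ω ^ 4 ∂μ :=
    integral_mono (((hX.pow 2).integrable.const_mul _).sub (integrable_const _))
      (hX.pow 4).integrable fun ω => by
        show 2 * b * X ω ^ 2 - b ^ 2 ≤ X ω ^ 4
        nlinarith [sq_nonneg (X ω ^ 2 - b)]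
  rw [integral_sub ((hX.pow 2).integrable.const_mul _) (integrable_const _),
    integral_const_mul] at h1
  simp only [integral_const, probReal_univ, one_smul] at h1
  nlinarith

/-- Second and fourth moments of a sum of centred variables, each of which is independent of every
sum of the others. -/
lemma moments_sum_le {ι : Type*} {X : ι → Ω → ℝ} (hX : ∀ i, AllMoments (X i) μ)
    (h0 : ∀ i, ∫ ω, X i ω ∂μ = 0) {b : ℝ} (hb : 0 < b) (h4 : ∀ i, ∫ ω, X i ω ^ 4 ∂μ ≤ b ^ 2)
    (hind : ∀ (s : Finset ι) (k : ι), k ∉ s → IndepFun (fun ω => ∑ i ∈ s, X i ω) (X k) μ)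
    (s : Finset ι) :
    ∫ ω, (∑ i ∈ s, X i ω) ^ 2 ∂μ ≤ s.card * b ∧
      ∫ ω, (∑ i ∈ s, X i ω) ^ 4 ∂μ ≤ 3 * s.card ^ 2 * b ^ 2 := by
  classical
  induction s using Finset.induction_on with
  | empty => simp
  | insert k s hk ih =>
    obtain ⟨ih2, ih4⟩ := ih
    set S : Ω → ℝ := fun ω => ∑ i ∈ s, X i ω with hS
    have hSm : AllMoments S μ := AllMoments.sum s fun i _ => hX i
    have hi := hind s k hk
    have hX2 := integral_sq_le_of_integral_pow_four_le (hX k) hb (h4 k)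
    have prod : ∀ i j : ℕ, ∫ ω, S ω ^ i * X k ω ^ j ∂μ
        = (∫ ω, S ω ^ i ∂μ) * ∫ ω, X k ω ^ j ∂μ := fun i j =>
      IndepFun.integral_fun_mul_eq_mul_integral
        (hi.comp (φ := fun x => x ^ i) (ψ := fun x => x ^ j) (by fun_prop) (by fun_prop))
        (hSm.pow i).integrable.aestronglyMeasurable (hX k |>.pow j).integrable.aestronglyMeasurable
    have mom : ∀ i j : ℕ, AllMoments (fun ω => S ω ^ i * X k ω ^ j) μ := fun i j =>
      (hSm.pow i).mul ((hX k).pow j)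
    have momc : ∀ (c : ℝ) (i j : ℕ), AllMoments (fun ω => c * (S ω ^ i * X k ω ^ j)) μ :=
      fun c i j => (AllMoments.const c).mul (mom i j)
    have hX1 : ∫ ω, X k ω ^ 1 ∂μ = 0 := by simpa using h0 k
    have e2 : ∫ ω, (∑ i ∈ insert k s, X i ω) ^ 2 ∂μ
        = ∫ ω, S ω ^ 2 ∂μ + ∫ ω, X k ω ^ 2 ∂μ := by
      have : ∀ ω, (∑ i ∈ insert k s, X i ω) ^ 2
          = S ω ^ 2 * X k ω ^ 0 + 2 * (S ω ^ 1 * X k ω ^ 1) + S ω ^ 0 * X k ω ^ 2 := fun ω => by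
        rw [Finset.sum_insert hk]; ring
      simp_rw [this]
      rw [integral_add ((mom 2 0).add (momc 2 1 1)).integrable (mom 0 2).integrable,
        integral_add (mom 2 0).integrable (momc 2 1 1).integrable, integral_const_mul, prod, prod,
        prod, hX1]
      simp
    have e4 : ∫ ω, (∑ i ∈ insert k s, X i ω) ^ 4 ∂μ
        = ∫ ω, S ω ^ 4 ∂μ + 6 * ((∫ ω, S ω ^ 2 ∂μ) * ∫ ω, X k ω ^ 2 ∂μ)
          + ∫ ω, X k ω ^ 4 ∂μ + 4 * ((∫ ω, S ω ∂μ) * ∫ ω, X k ω ^ 3 ∂μ) := by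
      have : ∀ ω, (∑ i ∈ insert k s, X i ω) ^ 4
          = S ω ^ 4 * X k ω ^ 0 + 4 * (S ω ^ 3 * X k ω ^ 1) + 6 * (S ω ^ 2 * X k ω ^ 2)
            + S ω ^ 0 * X k ω ^ 4 + 4 * (S ω ^ 1 * X k ω ^ 3) := fun ω => by
        rw [Finset.sum_insert hk]; ring
      simp_rw [this]
      rw [integral_add ((((mom 4 0).add (momc 4 3 1)).add (momc 6 2 2)).add (mom 0 4)).integrable
          (momc 4 1 3).integrable,
        integral_add (((mom 4 0).add (momc 4 3 1)).add (momc 6 2 2)).integrable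
          (mom 0 4).integrable,
        integral_add ((mom 4 0).add (momc 4 3 1)).integrable (momc 6 2 2).integrable,
        integral_add (mom 4 0).integrable (momc 4 3 1).integrable, integral_const_mul,
        integral_const_mul, integral_const_mul, prod, prod, prod, prod, prod, hX1]
      simp
    have hS0 : ∫ ω, S ω ∂μ = 0 := by
      rw [hS, integral_finsetSum _ fun i _ => (hX i).integrable]
      simp [h0]
    have hc : ((insert k s).card : ℝ) = s.card + 1 := by
      rw [Finset.card_insert_of_notMem hk]; push_cast; ring
    have hX2n : 0 ≤ ∫ ω, X k ω ^ 2 ∂μ := integral_nonneg fun ω => sq_nonneg _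
    rw [e2, e4, hc, hS0]
    refine ⟨by linarith, ?_⟩
    have := mul_le_mul ih2 hX2 hX2n (by positivity)
    nlinarith [h4 k, sq_nonneg b]

/-- Two mutually independent families that are independent of each other form an independent
family of pairs. -/
lemma iIndepFun_prodMk {ι : Type*} [Fintype ι] {X Y : ι → Ω → ℝ} (hX : iIndepFun X μ)
    (hY : iIndepFun Y μ) (mX : ∀ i, Measurable (X i)) (mY : ∀ i, Measurable (Y i))
    (hXY : IndepFun (fun ω i => X i ω) (fun ω i => Y i ω) μ) :
    iIndepFun (fun i ω => (X i ω, Y i ω)) μ := by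
  have pX : ∀ i, IsProbabilityMeasure (μ.map (X i)) := fun i =>
    Measure.isProbabilityMeasure_map (mX i).aemeasurable
  have pY : ∀ i, IsProbabilityMeasure (μ.map (Y i)) := fun i =>
    Measure.isProbabilityMeasure_map (mY i).aemeasurable
  have one : ∀ i, μ.map (fun ω => (X i ω, Y i ω)) = (μ.map (X i)).prod (μ.map (Y i)) := fun i =>
    (hXY.comp (φ := fun x : ι → ℝ => x i) (ψ := fun x : ι → ℝ => x i)
      (measurable_pi_apply i) (measurable_pi_apply i)).map_prod_eq_prod_map_map (mX i).aemeasurable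
        (mY i).aemeasurable
  rw [iIndepFun_iff_map_fun_eq_pi_map fun i => ((mX i).prodMk (mY i)).aemeasurable]
  simp_rw [one]
  apply (MeasurableEquiv.arrowProdEquivProdArrow ℝ ℝ ι).map_measurableEquiv_injective
  rw [(measurePreserving_arrowProdEquivProdArrow ℝ ℝ ι _ _).map_eq,
    Measure.map_map (MeasurableEquiv.measurable _)
      (measurable_pi_lambda _ fun i => (mX i).prodMk (mY i)),
    ← hX.map_fun_eq_pi_map fun i => (mX i).aemeasurable,
    ← hY.map_fun_eq_pi_map fun i => (mY i).aemeasurable,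
    ← hXY.map_prod_eq_prod_map_map (measurable_pi_lambda _ mX).aemeasurable
      (measurable_pi_lambda _ mY).aemeasurable]
  rfl

lemma variance_le_integral_sq {X : Ω → ℝ} (hX : AllMoments X μ) :
    variance X μ ≤ ∫ ω, X ω ^ 2 ∂μ :=
  variance_le_expectation_sq hX.integrable.aestronglyMeasurable

lemma integral_sq_eq_variance_add {X : Ω → ℝ} (hX : AllMoments X μ) :
    ∫ ω, X ω ^ 2 ∂μ = variance X μ + (∫ ω, X ω ∂μ) ^ 2 := by
  rw [variance_eq_sub hX.memLp_two]
  simp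

/-- A sub-Gaussian variable has fourth moment bounded in terms of its parameter. -/
lemma integral_pow_four_le_of_subgaussian {X : Ω → ℝ} {K : ℝ≥0} (h : HasSubgaussianMGF X K μ) :
    ∫ ω, X ω ^ 4 ∂μ ≤ 48 * Real.exp (K / 2) := by
  have hm : AllMoments X μ := h.memLp
  have e1 := h.mgf_le 1
  have e2 := h.mgf_le (-1)
  simp only [mgf] at e1 e2
  have i1 := h.integrable_exp_mul 1
  have i2 := h.integrable_exp_mul (-1)
  have : ∫ ω, X ω ^ 4 ∂μ
      ≤ ∫ ω, 24 * (Real.exp (1 * X ω) + Real.exp (-1 * X ω)) ∂μ := by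
    refine integral_mono (hm.pow 4).integrable ((i1.add i2).const_mul _) fun ω => ?_
    show X ω ^ 4 ≤ 24 * (Real.exp (1 * X ω) + Real.exp (-1 * X ω))
    have h4 := Real.pow_div_factorial_le_exp |X ω| (abs_nonneg _) 4
    have hf : ((Nat.factorial 4 : ℕ) : ℝ) = 24 := by norm_num [Nat.factorial]
    rw [hf, show |X ω| ^ 4 = X ω ^ 4 from (by decide : Even 4).pow_abs _] at h4
    have h5 : Real.exp |X ω| ≤ Real.exp (1 * X ω) + Real.exp (-1 * X ω) := by
      rcases abs_cases (X ω) with ⟨h, -⟩ | ⟨h, -⟩ <;> rw [h] <;>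
        simp [Real.exp_nonneg]
    linarith
  rw [integral_const_mul, integral_add i1 i2] at this
  have e3 : (K : ℝ) * 1 ^ 2 / 2 = K / 2 := by ring
  have e4 : (K : ℝ) * (-1) ^ 2 / 2 = K / 2 := by ring
  rw [e3] at e1
  rw [e4] at e2
  linarith

end Moments

/-! ### Gram matrices of matrices with independent entries -/

lemma sub_pow_four_le (x y : ℝ) : (x - y) ^ 4 ≤ 8 * (x ^ 4 + y ^ 4) := by
  nlinarith [sq_nonneg (x ^ 2 - y ^ 2), sq_nonneg (x + y), sq_nonneg ((x + y) ^ 2),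
    mul_nonneg (sq_nonneg (x + y)) (sq_nonneg (x - y)), sq_nonneg (x * y)]

section Gram

variable {Ω : Type*} [MeasurableSpace Ω] {μ : Measure Ω} {n d : ℕ}
  {Z : Fin n × Fin d → Ω → ℝ}

lemma indepFun_rows (hZ : iIndepFun Z μ) (hm : ∀ i, Measurable (Z i))
    {s : Finset (Fin n)} {k : Fin n} (hk : k ∉ s) {φ : Fin n → (Fin d → ℝ) → ℝ}
    (hφ : ∀ k, Measurable (φ k)) :
    IndepFun (fun ω => ∑ j ∈ s, φ j fun h => Z (j, h) ω) (fun ω => φ k fun h => Z (k, h) ω) μ := by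
  classical
  refine indepFun_of_dependsOn hZ hm (S := Finset.univ.filter fun i => i.1 ∈ s)
    (T := Finset.univ.filter fun i => i.1 = k)
    (F := fun x => ∑ j ∈ s, φ j fun h => x (j, h)) (G := fun x => φ k fun h => x (k, h))
    ?_ (by fun_prop) (by fun_prop) ?_ ?_
  · rw [Finset.disjoint_filter]
    rintro i - hi rfl
    exact hk hi
  · intro x y hxy
    refine Finset.sum_congr rfl fun j hj => ?_
    congr 1
    funext h
    exact hxy (j, h) (by simp [hj])
  · intro x y hxy
    show φ k _ = φ k _
    congr 1
    funext h
    exact hxy (k, h) (by simp)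

lemma integral_mul_of_ne (hZ : iIndepFun Z μ) (hm : ∀ i, Measurable (Z i)) {i j : Fin n × Fin d}
    (hij : i ≠ j) (a b : ℕ) :
    ∫ ω, Z i ω ^ a * Z j ω ^ b ∂μ = (∫ ω, Z i ω ^ a ∂μ) * ∫ ω, Z j ω ^ b ∂μ :=
  IndepFun.integral_fun_mul_eq_mul_integral
    ((hZ.indepFun hij).comp (φ := fun x => x ^ a) (ψ := fun x => x ^ b) (by fun_prop)
      (by fun_prop)) ((hm i).pow_const a).aestronglyMeasurable
    ((hm j).pow_const b).aestronglyMeasurable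

variable [IsProbabilityMeasure μ]

/-- The centred sum over rows has the variance of its terms added up. -/
lemma integral_rows_sq_le (hZ : iIndepFun Z μ) (hm : ∀ i, Measurable (Z i))
    {φ : Fin n → (Fin d → ℝ) → ℝ} (hφ : ∀ k, Measurable (φ k))
    (hmom : ∀ k, AllMoments (fun ω => φ k fun h => Z (k, h) ω) μ) {t : ℝ}
    (ht : ∀ k, ∫ ω, (φ k fun h => Z (k, h) ω) ^ 2 ∂μ ≤ t) :
    ∫ ω, (∑ k, ((φ k fun h => Z (k, h) ω) - ∫ ω', (φ k fun h => Z (k, h) ω') ∂μ)) ^ 2 ∂μ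
      ≤ n * t := by
  set X : Fin n → Ω → ℝ := fun k ω => φ k fun h => Z (k, h) ω with hX
  have hS : AllMoments (fun ω => ∑ k, X k ω) μ := AllMoments.sum _ fun k _ => hmom k
  have e : ∀ ω, ∑ k, (X k ω - ∫ ω', X k ω' ∂μ)
      = (∑ k, X k ω) - ∫ ω', (∑ k, X k ω') ∂μ := fun ω => by
    rw [Finset.sum_sub_distrib, integral_finsetSum _ fun k _ => (hmom k).integrable]
  have hv : variance (∑ k, X k) μ = ∑ k, variance (X k) μ :=
    IndepFun.variance_sum (fun k _ => (hmom k).memLp_two) fun j _ k _ hjk => by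
      have := indepFun_rows hZ hm (s := {j}) (k := k) (by simpa using hjk.symm) hφ
      simpa using this
  have hf : (∑ k, X k) = fun ω => ∑ k, X k ω := by
    funext ω; simp
  calc ∫ ω, (∑ k, (X k ω - ∫ ω', X k ω' ∂μ)) ^ 2 ∂μ
      = variance (fun ω => ∑ k, X k ω) μ := by
        simp_rw [e]; exact integral_sub_mean_sq_eq_variance hS
    _ = ∑ k, variance (X k) μ := by rw [← hf, hv]
    _ ≤ ∑ _k : Fin n, t :=
        Finset.sum_le_sum fun k _ => (variance_le_integral_sq (hmom k)).trans (ht k)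
    _ = n * t := by simp

variable {mm : Fin n × Fin d → ℝ}

/-- Second moment of one coordinate of the off-diagonal part of `ZᵀZ - E[ZᵀZ]` applied to a vector
`u`. The factor `τ` from the column `h` and the factor `τ + d ρ²` from the rest of the row are both
small when the sampling probability is small. -/
lemma integral_gram_mulVec_sq_le (hZ : iIndepFun Z μ) (hm : ∀ i, Measurable (Z i))
    (hmom : ∀ i, AllMoments (Z i) μ) (hmean : ∀ i, ∫ ω, Z i ω ∂μ = mm i) {τ ρ : ℝ}
    (hmm : ∀ i, mm i ^ 2 ≤ ρ ^ 2) (hτ : ∀ i, ∫ ω, Z i ω ^ 2 ∂μ ≤ τ) (hτ0 : 0 ≤ τ) (h : Fin d)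
    {u : Fin d → ℝ} (hu : u h = 0) (hu1 : ∑ j, u j ^ 2 ≤ 1) :
    ∫ ω, (∑ k, ∑ j, (Z (k, h) ω * Z (k, j) ω - mm (k, h) * mm (k, j)) * u j) ^ 2 ∂μ
      ≤ n * (τ * (τ + d * ρ ^ 2)) := by
  classical
  have amom : ∀ k, AllMoments (fun ω => ∑ j, Z (k, j) ω * u j) μ := fun k =>
    AllMoments.sum _ fun j _ => (hmom _).mul (AllMoments.const _)
  have hind : ∀ k, IndepFun (fun ω => Z (k, h) ω) (fun ω => ∑ j, Z (k, j) ω * u j) μ := fun k => by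
    refine indepFun_of_dependsOn hZ hm (S := {(k, h)})
      (T := Finset.univ.filter fun i => i.2 ≠ h)
      (F := fun x => x (k, h)) (G := fun x => ∑ j, x (k, j) * u j) (by simp)
      (by fun_prop) (by fun_prop) (fun x y hxy => hxy (k, h) (by simp)) fun x y hxy => ?_
    refine Finset.sum_congr rfl fun j _ => ?_
    by_cases hj : j = h
    · rw [hj, hu]; simp
    · rw [hxy (k, j) (by simp [hj])]
  have amean : ∀ k, ∫ ω, (∑ j, Z (k, j) ω * u j) ∂μ = ∑ j, mm (k, j) * u j := fun k => by
    rw [integral_finsetSum _ fun j _ => ((hmom _).mul (AllMoments.const _)).integrable]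
    simp_rw [integral_mul_const, hmean]
  have pmean : ∀ k, ∫ ω, Z (k, h) ω * (∑ j, Z (k, j) ω * u j) ∂μ
      = mm (k, h) * ∑ j, mm (k, j) * u j := fun k => by
    rw [(hind k).integral_fun_mul_eq_mul_integral (hmom _).integrable.aestronglyMeasurable
      (amom k).integrable.aestronglyMeasurable, hmean, amean]
  have asq : ∀ k, ∫ ω, (∑ j, Z (k, j) ω * u j) ^ 2 ∂μ ≤ τ + d * ρ ^ 2 := fun k => by
    rw [integral_sq_eq_variance_add (amom k), amean]
    have hv : variance (fun ω => ∑ j, Z (k, j) ω * u j) μ ≤ τ := by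
      have hf : (fun ω => ∑ j, Z (k, j) ω * u j) = ∑ j, fun ω => Z (k, j) ω * u j := by
        funext ω; simp
      rw [hf, IndepFun.variance_sum
        (fun j _ => ((hmom (k, j)).mul (AllMoments.const (u j))).memLp_two)
        (fun i _ j _ hij => (hZ.indepFun (show (k, i) ≠ (k, j) by simpa using hij)).comp
          (φ := fun x => x * u i) (ψ := fun x => x * u j) (by fun_prop) (by fun_prop))]
      calc ∑ j, variance (fun ω => Z (k, j) ω * u j) μ ≤ ∑ j, τ * u j ^ 2 := by
            refine Finset.sum_le_sum fun j _ => ?_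
            rw [variance_mul_const]
            exact mul_le_mul_of_nonneg_right ((variance_le_integral_sq (hmom _)).trans (hτ _))
              (sq_nonneg _)
        _ ≤ τ := by rw [← Finset.mul_sum]; exact mul_le_of_le_one_right hτ0 hu1
    have hq : (∑ j, mm (k, j) * u j) ^ 2 ≤ d * ρ ^ 2 := by
      refine (Finset.sum_mul_sq_le_sq_mul_sq _ _ _).trans ?_
      have h1 : ∑ j, mm (k, j) ^ 2 ≤ d * ρ ^ 2 := by
        refine (Finset.sum_le_sum fun j _ => hmm (k, j)).trans ?_
        simp
      exact (mul_le_of_le_one_right (Finset.sum_nonneg fun _ _ => sq_nonneg _) hu1).trans h1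
    linarith
  have key := integral_rows_sq_le hZ hm (φ := fun _ x => x h * ∑ j, x j * u j)
    (fun _ => by fun_prop) (fun k => (hmom (k, h)).mul (amom k)) (t := τ * (τ + d * ρ ^ 2))
    fun k => by
      have : ∫ ω, (Z (k, h) ω * ∑ j, Z (k, j) ω * u j) ^ 2 ∂μ
          = (∫ ω, Z (k, h) ω ^ 2 ∂μ) * ∫ ω, (∑ j, Z (k, j) ω * u j) ^ 2 ∂μ := by
        simp_rw [mul_pow]
        exact ((hind k).comp (φ := fun x => x ^ 2) (ψ := fun x => x ^ 2) (by fun_prop)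
          (by fun_prop)).integral_fun_mul_eq_mul_integral
            ((hmom _).pow 2).integrable.aestronglyMeasurable
            ((amom k).pow 2).integrable.aestronglyMeasurable
      rw [this]
      exact mul_le_mul (hτ _) (asq k) (integral_nonneg fun _ => sq_nonneg _) hτ0
  simp_rw [pmean] at key
  refine le_trans (le_of_eq ?_) key
  congr 1
  funext ω
  congr 1
  refine Finset.sum_congr rfl fun k _ => ?_
  rw [Finset.mul_sum, Finset.mul_sum, ← Finset.sum_sub_distrib]
  exact Finset.sum_congr rfl fun j _ => by ring

/-- Fourth moment of an off-diagonal entry of `ZᵀZ - E[ZᵀZ]`. -/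
lemma integral_gram_pow_four_le (hZ : iIndepFun Z μ) (hm : ∀ i, Measurable (Z i))
    (hmom : ∀ i, AllMoments (Z i) μ) (hmean : ∀ i, ∫ ω, Z i ω ∂μ = mm i) {B : ℝ} (hB : 0 < B)
    (hmm : ∀ i, mm i ^ 4 ≤ B) (h4 : ∀ i, ∫ ω, Z i ω ^ 4 ∂μ ≤ B) {h j : Fin d} (hj : h ≠ j) :
    ∫ ω, (∑ k, (Z (k, h) ω * Z (k, j) ω - mm (k, h) * mm (k, j))) ^ 4 ∂μ
      ≤ 48 * n ^ 2 * B ^ 2 := by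
  have hne : ∀ k : Fin n, (k, h) ≠ (k, j) := fun k => by simpa using hj
  have pm : ∀ k : Fin n, AllMoments (fun ω => Z (k, h) ω * Z (k, j) ω) μ := fun k =>
    (hmom _).mul (hmom _)
  have := (moments_sum_le (X := fun k ω => Z (k, h) ω * Z (k, j) ω - mm (k, h) * mm (k, j))
    (fun k => (pm k).sub (AllMoments.const _)) (fun k => ?_) (b := 4 * B) (by positivity)
    (fun k => ?_) (fun s k hk => ?_) Finset.univ).2
  · simp only [Finset.card_univ, Fintype.card_fin] at this
    linarith
  · rw [integral_sub (pm k).integrable (integrable_const _)]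
    have e := integral_mul_of_ne hZ hm (hne k) 1 1
    simp only [pow_one, hmean] at e
    simp [e]
  · have e := integral_mul_of_ne hZ hm (hne k) 4 4
    have hmB : (mm (k, h) * mm (k, j)) ^ 4 ≤ B ^ 2 := by
      rw [mul_pow, sq]
      exact mul_le_mul (hmm _) (hmm _) (by positivity) hB.le
    have hZB : ∫ ω, Z (k, h) ω ^ 4 * Z (k, j) ω ^ 4 ∂μ ≤ B ^ 2 := by
      rw [e, sq]
      exact mul_le_mul (h4 _) (h4 _) (integral_nonneg fun _ => by positivity) hB.le
    calc ∫ ω, (Z (k, h) ω * Z (k, j) ω - mm (k, h) * mm (k, j)) ^ 4 ∂μ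
        ≤ ∫ ω, 8 * (Z (k, h) ω ^ 4 * Z (k, j) ω ^ 4 + (mm (k, h) * mm (k, j)) ^ 4) ∂μ := by
          refine integral_mono (((pm k).sub (AllMoments.const _)).pow 4).integrable
            ((AllMoments.const 8).mul ((((hmom _).pow 4).mul ((hmom _).pow 4)).add
              (AllMoments.const _))).integrable fun ω => ?_
          show (Z (k, h) ω * Z (k, j) ω - mm (k, h) * mm (k, j)) ^ 4
            ≤ 8 * (Z (k, h) ω ^ 4 * Z (k, j) ω ^ 4 + (mm (k, h) * mm (k, j)) ^ 4)
          rw [← mul_pow]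
          have := sub_pow_four_le (Z (k, h) ω * Z (k, j) ω)
            (mm (k, h) * mm (k, j))
          linarith
      _ = 8 * (∫ ω, Z (k, h) ω ^ 4 * Z (k, j) ω ^ 4 ∂μ + (mm (k, h) * mm (k, j)) ^ 4) := by
          rw [integral_const_mul, integral_add (((hmom _).pow 4).mul ((hmom _).pow 4)).integrable
            (integrable_const _)]
          simp
      _ ≤ (4 * B) ^ 2 := by nlinarith
  · exact indepFun_rows hZ hm hk (φ := fun k x => x h * x j - mm (k, h) * mm (k, j))
      fun _ => by fun_prop

/-- Second moment of a centred diagonal entry of `ZᵀZ`. -/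
lemma integral_gram_diag_sq_le (hZ : iIndepFun Z μ) (hm : ∀ i, Measurable (Z i))
    (hmom : ∀ i, AllMoments (Z i) μ) {B : ℝ} (h4 : ∀ i, ∫ ω, Z i ω ^ 4 ∂μ ≤ B) (h : Fin d) :
    ∫ ω, (∑ k, (Z (k, h) ω ^ 2 - ∫ ω', Z (k, h) ω' ^ 2 ∂μ)) ^ 2 ∂μ ≤ n * B := by
  refine integral_rows_sq_le hZ hm (φ := fun _ x => x h ^ 2) (fun _ => by fun_prop)
    (fun k => (hmom _).pow 2) fun k => ?_
  simpa only [← pow_mul] using h4 (k, h)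

end Gram

/-! ### Moments of the observed matrix -/

section Model

variable {Ω : Type*} [MeasurableSpace Ω] {μ : Measure Ω} {n d : ℕ}
  {ε y : Ω → Matrix (Fin n) (Fin d) ℝ} {σ : ℝ} {K : ℝ≥0} {p : ℝ}
  {M₀ : Matrix (Fin n) (Fin d) ℝ} {L : ℝ}

/-- The entries of the observed matrix as a family of random variables indexed by positions. -/
def obsEntry (M₀ : Matrix (Fin n) (Fin d) ℝ) (ε y : Ω → Matrix (Fin n) (Fin d) ℝ)
    (i : Fin n × Fin d) (ω : Ω) : ℝ := observed M₀ (ε ω) (y ω) i.1 i.2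

/-- Bound for the fourth moment of an entry of `M₀ + ε`. -/
noncomputable def fourthBound (L : ℝ) (K : ℝ≥0) : ℝ := 8 * (L ^ 4 + 48 * Real.exp (K / 2))

lemma fourthBound_pos (L : ℝ) (K : ℝ≥0) : 0 < fourthBound L K := by
  unfold fourthBound; positivity

lemma pow_four_le_fourthBound (K : ℝ≥0) {x : ℝ} (hx : |x| ≤ L) : x ^ 4 ≤ fourthBound L K := by
  have h : x ^ 4 ≤ L ^ 4 := by
    rw [← (by decide : Even 4).pow_abs x]
    exact pow_le_pow_left₀ (abs_nonneg _) hx 4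
  unfold fourthBound
  nlinarith [Real.exp_pos ((K : ℝ) / 2), pow_nonneg ((abs_nonneg x).trans hx) 4]

namespace IsModel

lemma transpose (h : IsModel μ ε y σ K p) :
    IsModel μ (fun ω => (ε ω)ᵀ) (fun ω => (y ω)ᵀ) σ K p where
  noise_measurable k j := h.noise_measurable j k
  noise_indep := h.noise_indep.precomp Prod.swap_injective
  noise_identDistrib k j k' j' := h.noise_identDistrib j k j' k'
  noise_subgaussian k j := h.noise_subgaussian j k
  noise_mean k j := h.noise_mean j k
  noise_variance k j := h.noise_variance j k
  mask_measurable k j := h.mask_measurable j k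
  mask_values ω k j := h.mask_values ω j k
  mask_prob k j := h.mask_prob j k
  mask_indep := h.mask_indep.precomp Prod.swap_injective
  indep := h.indep.comp (φ := fun (x : Fin n × Fin d → ℝ) (kh : Fin d × Fin n) => x (kh.2, kh.1))
    (ψ := fun (x : Fin n × Fin d → ℝ) (kh : Fin d × Fin n) => x (kh.2, kh.1))
    (by fun_prop) (by fun_prop)

lemma noise_allMoments (h : IsModel μ ε y σ K p) (k : Fin n) (j : Fin d) :
    AllMoments (fun ω => ε ω k j) μ := (h.noise_subgaussian k j).memLp

lemma mask_sq (h : IsModel μ ε y σ K p) (ω : Ω) (k : Fin n) (j : Fin d) :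
    y ω k j ^ 2 = y ω k j := by
  rcases h.mask_values ω k j with e | e <;> simp [e]

lemma mask_nonneg (h : IsModel μ ε y σ K p) (ω : Ω) (k : Fin n) (j : Fin d) : 0 ≤ y ω k j := by
  rcases h.mask_values ω k j with e | e <;> simp [e]

lemma mask_le_one (h : IsModel μ ε y σ K p) (ω : Ω) (k : Fin n) (j : Fin d) : y ω k j ≤ 1 := by
  rcases h.mask_values ω k j with e | e <;> simp [e]

lemma integral_mask (h : IsModel μ ε y σ K p) (k : Fin n) (j : Fin d) :
    ∫ ω, y ω k j ∂μ = p := by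
  have e : (fun ω => y ω k j) = Set.indicator {ω | y ω k j = 1} 1 := by
    funext ω
    rcases h.mask_values ω k j with e | e <;> simp [Set.indicator, e]
  have hs : MeasurableSet {ω | y ω k j = 1} :=
    h.mask_measurable k j (measurableSet_singleton 1)
  rw [e, integral_indicator_one hs, h.mask_prob]

lemma noise_indepFun_mask (h : IsModel μ ε y σ K p) (k : Fin n) (j : Fin d) {f g : ℝ → ℝ}
    (hf : Measurable f) (hg : Measurable g) :
    IndepFun (fun ω => f (y ω k j)) (fun ω => g (ε ω k j)) μ :=
  (h.indep.comp (φ := fun x : Fin n × Fin d → ℝ => g (x (k, j)))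
    (ψ := fun x : Fin n × Fin d → ℝ => f (x (k, j)))
    (by fun_prop) (by fun_prop)).symm

lemma obsEntry_measurable (h : IsModel μ ε y σ K p) (M₀ : Matrix (Fin n) (Fin d) ℝ)
    (i : Fin n × Fin d) : Measurable (obsEntry M₀ ε y i) :=
  (h.mask_measurable i.1 i.2).mul (measurable_const.add (h.noise_measurable i.1 i.2))

lemma obsEntry_pow_four_le (h : IsModel μ ε y σ K p) (i : Fin n × Fin d) (ω : Ω) :
    obsEntry M₀ ε y i ω ^ 4 ≤ (M₀ i.1 i.2 + ε ω i.1 i.2) ^ 4 := by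
  simp only [obsEntry, observed, Matrix.of_apply, mul_pow]
  exact mul_le_of_le_one_left (by positivity)
    (pow_le_one₀ (h.mask_nonneg _ _ _) (h.mask_le_one _ _ _))

variable [IsProbabilityMeasure μ]

lemma integral_noise_sq (h : IsModel μ ε y σ K p) (k : Fin n) (j : Fin d) :
    ∫ ω, ε ω k j ^ 2 ∂μ = σ ^ 2 := by
  rw [integral_sq_eq_variance_add (h.noise_allMoments k j), h.noise_variance, h.noise_mean]
  ring

lemma mask_allMoments (h : IsModel μ ε y σ K p) (k : Fin n) (j : Fin d) :
    AllMoments (fun ω => y ω k j) μ := fun q =>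
  MemLp.of_bound (h.mask_measurable k j).aestronglyMeasurable 1 <| ae_of_all _ fun ω => by
    rw [Real.norm_eq_abs, abs_of_nonneg (h.mask_nonneg ω k j)]
    exact h.mask_le_one ω k j

lemma signal_add_noise_allMoments (h : IsModel μ ε y σ K p) (M₀ : Matrix (Fin n) (Fin d) ℝ)
    (k : Fin n) (j : Fin d) : AllMoments (fun ω => M₀ k j + ε ω k j) μ :=
  (AllMoments.const _).add (h.noise_allMoments k j)

lemma integral_signal_add_noise_sq (h : IsModel μ ε y σ K p) (M₀ : Matrix (Fin n) (Fin d) ℝ)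
    (k : Fin n) (j : Fin d) : ∫ ω, (M₀ k j + ε ω k j) ^ 2 ∂μ = M₀ k j ^ 2 + σ ^ 2 := by
  have hε := h.noise_allMoments k j
  have hm : AllMoments (fun ω => 2 * M₀ k j * ε ω k j) μ := (AllMoments.const _).mul hε
  have e : ∀ ω, (M₀ k j + ε ω k j) ^ 2
      = M₀ k j ^ 2 + 2 * M₀ k j * ε ω k j + ε ω k j ^ 2 := fun ω => by ring
  simp_rw [e]
  rw [integral_add ((AllMoments.const _).add hm).integrable (hε.pow 2).integrable,
    integral_add (integrable_const _) hm.integrable, integral_const_mul, h.noise_mean,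
    h.integral_noise_sq]
  simp

lemma integral_signal_add_noise_pow_four_le (h : IsModel μ ε y σ K p)
    (hL : ∀ k j, |M₀ k j| ≤ L) (k : Fin n) (j : Fin d) :
    ∫ ω, (M₀ k j + ε ω k j) ^ 4 ∂μ ≤ fourthBound L K := by
  have hε := h.noise_allMoments k j
  calc ∫ ω, (M₀ k j + ε ω k j) ^ 4 ∂μ ≤ ∫ ω, 8 * (L ^ 4 + ε ω k j ^ 4) ∂μ := by
        refine integral_mono ((h.signal_add_noise_allMoments M₀ k j).pow 4).integrable
          ((AllMoments.const 8).mul ((AllMoments.const _).add (hε.pow 4))).integrable fun ω => ?_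
        have h1 := sub_pow_four_le (M₀ k j) (-ε ω k j)
        have h2 : M₀ k j ^ 4 ≤ L ^ 4 := by
          rw [← (by decide : Even 4).pow_abs]
          exact pow_le_pow_left₀ (abs_nonneg _) (hL k j) 4
        rw [sub_neg_eq_add, (by decide : Even 4).neg_pow] at h1
        show (M₀ k j + ε ω k j) ^ 4 ≤ 8 * (L ^ 4 + ε ω k j ^ 4)
        linarith
    _ = 8 * (L ^ 4 + ∫ ω, ε ω k j ^ 4 ∂μ) := by
        rw [integral_const_mul, integral_add (integrable_const _) (hε.pow 4).integrable]
        simp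
    _ ≤ fourthBound L K := by
        have := integral_pow_four_le_of_subgaussian (h.noise_subgaussian k j)
        unfold fourthBound
        linarith

lemma obsEntry_allMoments (h : IsModel μ ε y σ K p) (M₀ : Matrix (Fin n) (Fin d) ℝ)
    (i : Fin n × Fin d) : AllMoments (obsEntry M₀ ε y i) μ :=
  (h.mask_allMoments i.1 i.2).mul (h.signal_add_noise_allMoments M₀ i.1 i.2)

lemma obsEntry_indep (h : IsModel μ ε y σ K p) (M₀ : Matrix (Fin n) (Fin d) ℝ) :
    iIndepFun (obsEntry M₀ ε y) μ :=
  (iIndepFun_prodMk h.noise_indep h.mask_indep (fun i => h.noise_measurable i.1 i.2)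
    (fun i => h.mask_measurable i.1 i.2) h.indep).comp (fun i x => x.2 * (M₀ i.1 i.2 + x.1))
      fun i => by fun_prop

lemma integral_obsEntry (h : IsModel μ ε y σ K p) (M₀ : Matrix (Fin n) (Fin d) ℝ)
    (i : Fin n × Fin d) : ∫ ω, obsEntry M₀ ε y i ω ∂μ = p * M₀ i.1 i.2 := by
  have := (h.noise_indepFun_mask i.1 i.2 (f := fun x => x) (g := fun x => M₀ i.1 i.2 + x)
    (by fun_prop) (by fun_prop)).integral_fun_mul_eq_mul_integral
    (h.mask_allMoments _ _).integrable.aestronglyMeasurable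
    (h.signal_add_noise_allMoments M₀ _ _).integrable.aestronglyMeasurable
  rw [h.integral_mask, integral_add (integrable_const _) (h.noise_allMoments _ _).integrable,
    h.noise_mean] at this
  simpa [obsEntry, observed] using this

lemma integral_obsEntry_sq (h : IsModel μ ε y σ K p) (M₀ : Matrix (Fin n) (Fin d) ℝ)
    (i : Fin n × Fin d) :
    ∫ ω, obsEntry M₀ ε y i ω ^ 2 ∂μ = p * (M₀ i.1 i.2 ^ 2 + σ ^ 2) := by
  have := (h.noise_indepFun_mask i.1 i.2 (f := fun x => x) (g := fun x => (M₀ i.1 i.2 + x) ^ 2)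
    (by fun_prop) (by fun_prop)).integral_fun_mul_eq_mul_integral
    (h.mask_allMoments _ _).integrable.aestronglyMeasurable
    ((h.signal_add_noise_allMoments M₀ _ _).pow 2).integrable.aestronglyMeasurable
  rw [h.integral_mask, h.integral_signal_add_noise_sq] at this
  rw [← this]
  congr 1
  funext ω
  simp only [obsEntry, observed, Matrix.of_apply, mul_pow, h.mask_sq]

lemma integral_obsEntry_pow_four_le (h : IsModel μ ε y σ K p) (hL : ∀ k j, |M₀ k j| ≤ L)
    (i : Fin n × Fin d) : ∫ ω, obsEntry M₀ ε y i ω ^ 4 ∂μ ≤ fourthBound L K :=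
  (integral_mono ((h.obsEntry_allMoments M₀ i).pow 4).integrable
    ((h.signal_add_noise_allMoments M₀ _ _).pow 4).integrable
    (h.obsEntry_pow_four_le i)).trans (h.integral_signal_add_noise_pow_four_le hL _ _)

/-! ### The estimated sampling probability -/

lemma phat_sub_allMoments (h : IsModel μ ε y σ K p) :
    AllMoments (fun ω => phat (y ω) - p) μ := by
  have : AllMoments (fun ω => (∑ k, ∑ j, y ω k j) * ((n : ℝ) * d)⁻¹ - p) μ :=
    ((AllMoments.sum _ fun k _ => AllMoments.sum _ fun j _ => h.mask_allMoments k j).mul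
      (AllMoments.const _)).sub (AllMoments.const _)
  simpa only [phat, div_eq_mul_inv] using this

lemma integral_phat_sub_sq_le (h : IsModel μ ε y σ K p) (hn : 0 < n) (hd : 0 < d) :
    ∫ ω, (phat (y ω) - p) ^ 2 ∂μ ≤ ((n : ℝ) * d)⁻¹ := by
  have hN : (0 : ℝ) < (n : ℝ) * d := by positivity
  set Y : Fin n × Fin d → Ω → ℝ := fun i ω => y ω i.1 i.2 with hY
  have hYm : ∀ i, AllMoments (Y i) μ := fun i => h.mask_allMoments i.1 i.2
  have hp1 : p ≤ 1 := by
    rw [← h.mask_prob ⟨0, hn⟩ ⟨0, hd⟩]; exact measureReal_le_one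
  have hmean : ∫ ω, (∑ i, Y i ω) ∂μ = n * d * p := by
    rw [integral_finsetSum _ fun i _ => (hYm i).integrable]
    simp [hY, h.integral_mask]
  have e : ∀ ω, (phat (y ω) - p) ^ 2
      = ((n : ℝ) * d)⁻¹ ^ 2 * (∑ i, Y i ω - ∫ ω', (∑ i, Y i ω') ∂μ) ^ 2 := fun ω => by
    rw [hmean, phat, ← mul_pow, hY, Fintype.sum_prod_type]
    congr 1
    field_simp
  have hv : variance (∑ i, Y i) μ = ∑ i, variance (Y i) μ :=
    IndepFun.variance_sum (fun i _ => (hYm i).memLp_two) fun i _ j _ hij =>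
      h.mask_indep.indepFun hij
  have hf : (∑ i, Y i) = fun ω => ∑ i, Y i ω := by
    funext ω; simp
  simp_rw [e]
  rw [integral_const_mul, integral_sub_mean_sq_eq_variance (AllMoments.sum _ fun i _ => hYm i),
    ← hf, hv]
  calc ((n : ℝ) * d)⁻¹ ^ 2 * ∑ i, variance (Y i) μ
      ≤ ((n : ℝ) * d)⁻¹ ^ 2 * ∑ _i : Fin n × Fin d, 1 := by
        refine mul_le_mul_of_nonneg_left (Finset.sum_le_sum fun i _ => ?_) (by positivity)
        refine (variance_le_integral_sq (hYm i)).trans ?_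
        simp only [hY, h.mask_sq, h.integral_mask]
        exact hp1
    _ = ((n : ℝ) * d)⁻¹ := by
        simp
        field_simp

/-- The error of `p̂` is independent of the noise, and masking only decreases fourth powers. -/
lemma integral_phat_sub_sq_mul_le (h : IsModel μ ε y σ K p) (hn : 0 < n) (hd : 0 < d)
    (hL : ∀ k j, |M₀ k j| ≤ L) (i : Fin n × Fin d) :
    ∫ ω, (phat (y ω) - p) ^ 2 * obsEntry M₀ ε y i ω ^ 4 ∂μ
      ≤ ((n : ℝ) * d)⁻¹ * fourthBound L K := by
  have hq := h.phat_sub_allMoments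
  have hs := h.signal_add_noise_allMoments M₀ i.1 i.2
  have hind : IndepFun (fun ω => (phat (y ω) - p) ^ 2)
      (fun ω => (M₀ i.1 i.2 + ε ω i.1 i.2) ^ 4) μ :=
    (h.indep.comp (φ := fun x : Fin n × Fin d → ℝ => (M₀ i.1 i.2 + x i) ^ 4)
      (ψ := fun x : Fin n × Fin d → ℝ => ((∑ k, ∑ j, x (k, j)) / ((n : ℝ) * d) - p) ^ 2)
      (by fun_prop) (by fun_prop)).symm
  calc ∫ ω, (phat (y ω) - p) ^ 2 * obsEntry M₀ ε y i ω ^ 4 ∂μ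
      ≤ ∫ ω, (phat (y ω) - p) ^ 2 * (M₀ i.1 i.2 + ε ω i.1 i.2) ^ 4 ∂μ :=
        integral_mono ((hq.pow 2).mul ((h.obsEntry_allMoments M₀ i).pow 4)).integrable
          ((hq.pow 2).mul (hs.pow 4)).integrable fun ω =>
            mul_le_mul_of_nonneg_left (h.obsEntry_pow_four_le i ω) (sq_nonneg _)
    _ = (∫ ω, (phat (y ω) - p) ^ 2 ∂μ) * ∫ ω, (M₀ i.1 i.2 + ε ω i.1 i.2) ^ 4 ∂μ :=
        hind.integral_fun_mul_eq_mul_integral (hq.pow 2).integrable.aestronglyMeasurable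
          (hs.pow 4).integrable.aestronglyMeasurable
    _ ≤ _ := mul_le_mul (h.integral_phat_sub_sq_le hn hd)
        (h.integral_signal_add_noise_pow_four_le hL _ _)
        (integral_nonneg fun _ => by positivity) (by positivity)

end IsModel

variable [IsProbabilityMeasure μ]

/-- A diagonal entry of `Σ̂ - p² (M₀ᵀM₀ + n σ² I)`. -/
noncomputable def diagError (M₀ : Matrix (Fin n) (Fin d) ℝ) (ε y : Ω → Matrix (Fin n) (Fin d) ℝ)
    (σ p : ℝ) (h : Fin d) (ω : Ω) : ℝ :=
  phat (y ω) * ∑ k, obsEntry M₀ ε y (k, h) ω ^ 2 - p ^ 2 * ∑ k, (M₀ k h ^ 2 + σ ^ 2)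

lemma IsModel.diagError_allMoments (h : IsModel μ ε y σ K p) (M₀ : Matrix (Fin n) (Fin d) ℝ)
    (j : Fin d) : AllMoments (diagError M₀ ε y σ p j) μ := by
  have hq : AllMoments (fun ω => phat (y ω)) μ := by
    simpa using h.phat_sub_allMoments.add (AllMoments.const p)
  exact (hq.mul (AllMoments.sum _ fun k _ => (h.obsEntry_allMoments M₀ (k, j)).pow 2)).sub
    (AllMoments.const _)

lemma IsModel.integral_diagError_sq_le (h : IsModel μ ε y σ K p) (hn : 0 < n) (hd : 0 < d)
    (hL : ∀ k j, |M₀ k j| ≤ L) (hp0 : 0 ≤ p) (hp1 : p ≤ 1) (j : Fin d) :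
    ∫ ω, diagError M₀ ε y σ p j ω ^ 2 ∂μ ≤ 4 * n * fourthBound L K := by
  set Z := obsEntry M₀ ε y with hZ
  have hq := h.phat_sub_allMoments
  have hZm : ∀ i, AllMoments (Z i) μ := h.obsEntry_allMoments M₀
  set T : Ω → ℝ := fun ω => ∑ k, (Z (k, j) ω ^ 2 - ∫ ω', Z (k, j) ω' ^ 2 ∂μ) with hT
  have hTm : AllMoments T μ := AllMoments.sum _ fun k _ =>
    ((hZm (k, j)).pow 2).sub (AllMoments.const _)
  have hT2 : ∫ ω, T ω ^ 2 ∂μ ≤ n * fourthBound L K :=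
    integral_gram_diag_sq_le (h.obsEntry_indep M₀) (h.obsEntry_measurable M₀) hZm
      (h.integral_obsEntry_pow_four_le hL) j
  set R : Ω → ℝ := fun ω => n * ∑ k, (phat (y ω) - p) ^ 2 * Z (k, j) ω ^ 4 with hR
  have hrm : ∀ k, AllMoments (fun ω => (phat (y ω) - p) ^ 2 * Z (k, j) ω ^ 4) μ := fun k =>
    (hq.pow 2).mul ((hZm (k, j)).pow 4)
  have hRm : AllMoments R μ := (AllMoments.const _).mul (AllMoments.sum _ fun k _ => hrm k)
  have hR1 : ∫ ω, R ω ∂μ ≤ n * fourthBound L K := by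
    have hB := fourthBound_pos L K
    rw [hR, integral_const_mul, integral_finsetSum _ fun k _ => (hrm k).integrable]
    refine mul_le_mul_of_nonneg_left ?_ (by positivity)
    refine (Finset.sum_le_sum fun k _ =>
      h.integral_phat_sub_sq_mul_le hn hd hL (k, j)).trans ?_
    have hn' : (0 : ℝ) < n := by exact_mod_cast hn
    have hd' : (1 : ℝ) ≤ d := by exact_mod_cast hd
    rw [Finset.sum_const, Finset.card_univ, Fintype.card_fin, nsmul_eq_mul, mul_inv,
      ← mul_assoc, ← mul_assoc, mul_inv_cancel₀ hn'.ne', one_mul]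
    exact mul_le_of_le_one_left hB.le (inv_le_one_of_one_le₀ hd')
  -- the error of `p̂` and the fluctuation of the column sum `∑ Z²` are estimated separately
  have split : ∀ ω, diagError M₀ ε y σ p j ω ^ 2 ≤ 2 * R ω + 2 * T ω ^ 2 := fun ω => by
    have e : diagError M₀ ε y σ p j ω
        = (phat (y ω) - p) * ∑ k, Z (k, j) ω ^ 2 + p * T ω := by
      simp only [diagError, hT, hZ, h.integral_obsEntry_sq, Finset.sum_sub_distrib,
        ← Finset.mul_sum]
      ring
    have hS : (∑ k, Z (k, j) ω ^ 2) ^ 2 ≤ n * ∑ k, Z (k, j) ω ^ 4 := by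
      have := sq_sum_le_card_mul_sum_sq (s := Finset.univ) (f := fun k => Z (k, j) ω ^ 2)
      simpa [← pow_mul] using this
    have h1 : ((phat (y ω) - p) * ∑ k, Z (k, j) ω ^ 2) ^ 2 ≤ R ω := by
      rw [hR, mul_pow]
      simp only [← Finset.mul_sum]
      calc _ ≤ (phat (y ω) - p) ^ 2 * (n * ∑ k, Z (k, j) ω ^ 4) :=
            mul_le_mul_of_nonneg_left hS (sq_nonneg _)
        _ = _ := by ring
    have h2 : (p * T ω) ^ 2 ≤ T ω ^ 2 := by
      rw [mul_pow]
      exact mul_le_of_le_one_left (sq_nonneg _) (pow_le_one₀ hp0 hp1)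
    rw [e]
    nlinarith [sq_nonneg ((phat (y ω) - p) * ∑ k, Z (k, j) ω ^ 2 - p * T ω)]
  calc ∫ ω, diagError M₀ ε y σ p j ω ^ 2 ∂μ ≤ ∫ ω, (2 * R ω + 2 * T ω ^ 2) ∂μ :=
        integral_mono ((h.diagError_allMoments M₀ j).pow 2).integrable
          (((AllMoments.const 2).mul hRm).add
            ((AllMoments.const 2).mul (hTm.pow 2))).integrable split
    _ = 2 * ∫ ω, R ω ∂μ + 2 * ∫ ω, T ω ^ 2 ∂μ := by
        rw [integral_add ((AllMoments.const 2).mul hRm).integrable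
          ((AllMoments.const 2).mul (hTm.pow 2)).integrable, integral_const_mul 2 R,
          integral_const_mul 2 fun ω => T ω ^ 2]
    _ ≤ _ := by linarith

end Model

/-! ### The error of the adjusted Gram matrix -/

section Error

variable {Ω : Type*} {n d r m : ℕ}
  {ε y : Ω → Matrix (Fin n) (Fin d) ℝ} {σ : ℝ} {K : ℝ≥0} {p : ℝ}
  {M₀ : Matrix (Fin n) (Fin d) ℝ} {L : ℝ}

/-- The off-diagonal part of `Σ̂ - p² (M₀ᵀM₀ + n σ² I)`, with zero diagonal. -/
def offDiagError (M₀ : Matrix (Fin n) (Fin d) ℝ) (ε y : Ω → Matrix (Fin n) (Fin d) ℝ) (p : ℝ)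
    (ω : Ω) : Matrix (Fin d) (Fin d) ℝ :=
  Matrix.of fun h j => if h = j then 0 else
    ∑ k, (obsEntry M₀ ε y (k, h) ω * obsEntry M₀ ε y (k, j) ω - p * M₀ k h * (p * M₀ k j))

lemma sigmaHat_eq (M₀ : Matrix (Fin n) (Fin d) ℝ) (ε y : Ω → Matrix (Fin n) (Fin d) ℝ)
    (σ p : ℝ) (ω : Ω) :
    sigmaHat (observed M₀ (ε ω) (y ω)) (y ω) = p ^ 2 • (M₀ᵀ * M₀) + (p ^ 2 * (n * σ ^ 2)) • 1
      + (offDiagError M₀ ε y p ω + Matrix.diagonal fun h => diagError M₀ ε y σ p h ω) := by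
  ext h j
  by_cases hj : h = j
  · subst hj
    simp only [sigmaHat, adjust, offDiagError, diagError, obsEntry, Matrix.sub_apply,
      Matrix.smul_apply, Matrix.diagonal_apply_eq, Matrix.mul_apply, Matrix.transpose_apply,
      Matrix.add_apply, Matrix.one_apply_eq, smul_eq_mul, Matrix.of_apply, if_true, sq,
      Finset.sum_add_distrib, Finset.sum_const, Finset.card_univ, Fintype.card_fin, nsmul_eq_mul]
    ring
  · simp only [sigmaHat, adjust, offDiagError, obsEntry, Matrix.sub_apply, Matrix.smul_apply,
      Matrix.diagonal_apply_ne _ hj, Matrix.mul_apply, Matrix.transpose_apply, Matrix.add_apply,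
      Matrix.one_apply_ne hj, smul_eq_mul, Matrix.of_apply, if_neg hj, Finset.sum_sub_distrib,
      Finset.mul_sum]
    have : ∀ k, p * M₀ k h * (p * M₀ k j) = p ^ 2 * (M₀ k h * M₀ k j) := fun k => by ring
    simp only [this]
    ring

lemma frobSq_diagonal (v : Fin d → ℝ) : frobSq (Matrix.diagonal v) = ∑ h, v h ^ 2 := by
  rw [frobSq_eq_sum]
  refine Finset.sum_congr rfl fun j _ => ?_
  rw [Finset.sum_eq_single j (fun i _ hi => by simp [hi]) (by simp), Matrix.diagonal_apply_eq]

lemma sum_col_sq_of_orthonormal {W : Matrix (Fin d) (Fin m) ℝ} (hW : Wᵀ * W = 1) (i : Fin m) :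
    ∑ h, W h i ^ 2 = 1 := by
  have := congrFun (congrFun hW i) i
  simpa [Matrix.mul_apply, sq] using this

/-- Right singular vectors diagonalise the Gram matrix. -/
lemma IsSVD.gram_eq {U : Matrix (Fin n) (Fin r) ℝ} {lam : Fin r → ℝ}
    {V : Matrix (Fin d) (Fin r) ℝ} (h : IsSVD M₀ U lam V) :
    M₀ᵀ * M₀ = V * Matrix.diagonal (fun i => lam i ^ 2) * Vᵀ := by
  have e : (Matrix.diagonal lam * Matrix.diagonal lam : Matrix (Fin r) (Fin r) ℝ)
      = Matrix.diagonal fun i => lam i ^ 2 := by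
    rw [Matrix.diagonal_mul_diagonal]; simp only [sq]
  rw [h.factor, ← e]
  simp only [Matrix.transpose_mul, Matrix.transpose_transpose, Matrix.diagonal_transpose,
    Matrix.mul_assoc]
  rw [← Matrix.mul_assoc Uᵀ, h.left_orthonormal, Matrix.one_mul]

lemma IsSVD.transpose {U : Matrix (Fin n) (Fin r) ℝ} {lam : Fin r → ℝ}
    {V : Matrix (Fin d) (Fin r) ℝ} (h : IsSVD M₀ U lam V) : IsSVD M₀ᵀ V lam U where
  left_orthonormal := h.right_orthonormal
  right_orthonormal := h.left_orthonormal
  pos := h.pos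
  antitone := h.antitone
  factor := by
    rw [h.factor]
    simp only [Matrix.transpose_mul, Matrix.transpose_transpose, Matrix.diagonal_transpose,
      Matrix.mul_assoc]

/-- The squared singular values add up to the squared Frobenius norm. -/
lemma IsSVD.sum_sq_le {U : Matrix (Fin n) (Fin r) ℝ} {lam : Fin r → ℝ}
    {V : Matrix (Fin d) (Fin r) ℝ} (h : IsSVD M₀ U lam V) (hL : ∀ k j, |M₀ k j| ≤ L) :
    ∑ i, lam i ^ 2 ≤ n * d * L ^ 2 := by
  have e : ∑ i, lam i ^ 2 = frobSq M₀ := by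
    rw [frobSq, h.gram_eq, Matrix.mul_assoc, Matrix.trace_mul_comm, Matrix.mul_assoc,
      h.right_orthonormal, Matrix.mul_one]
    simp [Matrix.trace]
  rw [e, frobSq_eq_sum]
  calc ∑ j, ∑ k, M₀ k j ^ 2 ≤ ∑ _j : Fin d, ∑ _k : Fin n, L ^ 2 :=
        Finset.sum_le_sum fun j _ => Finset.sum_le_sum fun k _ => sq_le_sq' (abs_le.1 (hL k j)).1
          (abs_le.1 (hL k j)).2
    _ = n * d * L ^ 2 := by simp; ring

variable [MeasurableSpace Ω] {μ : Measure Ω} [IsProbabilityMeasure μ]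

namespace IsModel

lemma offDiagError_allMoments (h : IsModel μ ε y σ K p) (M₀ : Matrix (Fin n) (Fin d) ℝ)
    (i j : Fin d) : AllMoments (fun ω => offDiagError M₀ ε y p ω i j) μ := by
  simp only [offDiagError, Matrix.of_apply]
  split_ifs
  · exact AllMoments.const 0
  · exact AllMoments.sum _ fun k _ => ((h.obsEntry_allMoments M₀ _).mul
      (h.obsEntry_allMoments M₀ _)).sub (AllMoments.const _)

lemma frobSq_offDiagError_allMoments (h : IsModel μ ε y σ K p) (M₀ : Matrix (Fin n) (Fin d) ℝ) :
    AllMoments (fun ω => frobSq (offDiagError M₀ ε y p ω)) μ := by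
  simp only [frobSq_eq_sum]
  exact AllMoments.sum _ fun j _ => AllMoments.sum _ fun i _ =>
    (h.offDiagError_allMoments M₀ i j).pow 2

lemma offDiagError_mul_allMoments (h : IsModel μ ε y σ K p) (M₀ : Matrix (Fin n) (Fin d) ℝ)
    (W : Matrix (Fin d) (Fin m) ℝ) (i : Fin d) (j : Fin m) :
    AllMoments (fun ω => (offDiagError M₀ ε y p ω * W) i j) μ := by
  simp only [Matrix.mul_apply]
  exact AllMoments.sum _ fun k _ => (h.offDiagError_allMoments M₀ i k).mul (AllMoments.const _)

lemma frobSq_offDiagError_mul_allMoments (h : IsModel μ ε y σ K p)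
    (M₀ : Matrix (Fin n) (Fin d) ℝ) (W : Matrix (Fin d) (Fin m) ℝ) :
    AllMoments (fun ω => frobSq (offDiagError M₀ ε y p ω * W)) μ := by
  simp only [frobSq_eq_sum]
  exact AllMoments.sum _ fun j _ => AllMoments.sum _ fun i _ =>
    (h.offDiagError_mul_allMoments M₀ W i j).pow 2

/-- The sharp second-moment bound, in which the sampling probability appears to the third power:
a vector with unit norm is hit by the off-diagonal error much less than the Frobenius norm of that
error would suggest. -/
lemma integral_frobSq_offDiagError_mul_le (h : IsModel μ ε y σ K p) (hL : ∀ k j, |M₀ k j| ≤ L)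
    (hp0 : 0 ≤ p) (hpd : 1 ≤ p * d) {W : Matrix (Fin d) (Fin m) ℝ} (hW : Wᵀ * W = 1) :
    ∫ ω, frobSq (offDiagError M₀ ε y p ω * W) ∂μ
      ≤ m * (p ^ 3 * n * d ^ 2 * ((L ^ 2 + σ ^ 2) * (2 * L ^ 2 + σ ^ 2))) := by
  set A := L ^ 2 + σ ^ 2 with hA
  have hA0 : 0 ≤ A := by positivity
  have hMsq : ∀ k j, M₀ k j ^ 2 ≤ L ^ 2 := fun k j =>
    sq_le_sq' (abs_le.1 (hL k j)).1 (abs_le.1 (hL k j)).2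
  have entry : ∀ i j, ∫ ω, (offDiagError M₀ ε y p ω * W) i j ^ 2 ∂μ
      ≤ n * (p * A * (p * A + d * (p * L) ^ 2)) := fun i j => by
    have := integral_gram_mulVec_sq_le (h.obsEntry_indep M₀) (h.obsEntry_measurable M₀)
      (h.obsEntry_allMoments M₀) (h.integral_obsEntry M₀) (τ := p * A) (ρ := p * L)
      (fun k => by
        rw [mul_pow, mul_pow]; exact mul_le_mul_of_nonneg_left (hMsq _ _) (sq_nonneg _))
      (fun k => by
        rw [h.integral_obsEntry_sq]
        exact mul_le_mul_of_nonneg_left (by linarith [hMsq k.1 k.2]) hp0) (by positivity) i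
      (u := fun k => if i = k then 0 else W k j) (by simp) (by
        rw [← sum_col_sq_of_orthonormal hW j]
        refine Finset.sum_le_sum fun k _ => ?_
        split_ifs
        · simpa using sq_nonneg _
        · exact le_rfl)
    refine le_trans (le_of_eq ?_) this
    congr 1
    funext ω
    congr 1
    rw [Finset.sum_comm, Matrix.mul_apply]
    refine Finset.sum_congr rfl fun k _ => ?_
    simp only [offDiagError, Matrix.of_apply]
    split_ifs
    · simp
    · rw [Finset.sum_mul]
  simp only [frobSq_eq_sum]
  have hm : ∀ i j, AllMoments (fun ω => (offDiagError M₀ ε y p ω * W) i j ^ 2) μ := fun i j =>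
    (h.offDiagError_mul_allMoments M₀ W i j).pow 2
  rw [integral_finsetSum _ fun j _ => (AllMoments.sum _ fun i _ => hm i j).integrable]
  simp_rw [integral_finsetSum _ fun i _ => (hm i _).integrable]
  calc ∑ j : Fin m, ∑ i : Fin d, ∫ ω, (offDiagError M₀ ε y p ω * W) i j ^ 2 ∂μ
      ≤ ∑ _j : Fin m, ∑ _i : Fin d, n * (p * A * (p * A + d * (p * L) ^ 2)) :=
        Finset.sum_le_sum fun j _ => Finset.sum_le_sum fun i _ => entry i j
    _ = m * (n * d * (p ^ 2 * A) * (A * 1 + p * d * L ^ 2)) := by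
        simp only [Finset.sum_const, Finset.card_univ, Fintype.card_fin, nsmul_eq_mul]
        ring
    _ ≤ m * (n * d * (p ^ 2 * A) * (A * (p * d) + p * d * L ^ 2)) := by gcongr
    _ = _ := by rw [hA]; ring

lemma integral_frobSq_offDiagError_sq_le (h : IsModel μ ε y σ K p) (hL : ∀ k j, |M₀ k j| ≤ L)
    (hp0 : 0 ≤ p) (hp1 : p ≤ 1) :
    ∫ ω, frobSq (offDiagError M₀ ε y p ω) ^ 2 ∂μ
      ≤ 48 * d ^ 4 * n ^ 2 * fourthBound L K ^ 2 := by
  have hB := fourthBound_pos L K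
  have entry : ∀ i j, ∫ ω, offDiagError M₀ ε y p ω i j ^ 4 ∂μ
      ≤ 48 * n ^ 2 * fourthBound L K ^ 2 := fun i j => by
    simp only [offDiagError, Matrix.of_apply]
    split_ifs with hij
    · simp only [ne_eq, OfNat.ofNat_ne_zero, not_false_eq_true, zero_pow, integral_zero]
      positivity
    · refine integral_gram_pow_four_le (h.obsEntry_indep M₀) (h.obsEntry_measurable M₀)
        (h.obsEntry_allMoments M₀) (mm := fun k => p * M₀ k.1 k.2) (h.integral_obsEntry M₀) hB
        (fun k => ?_) (h.integral_obsEntry_pow_four_le hL) hij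
      rw [mul_pow]
      exact (mul_le_of_le_one_left (by positivity) (pow_le_one₀ hp0 hp1)).trans
        (pow_four_le_fourthBound K (hL _ _))
  have hm : ∀ i j, AllMoments (fun ω => offDiagError M₀ ε y p ω i j ^ 4) μ := fun i j =>
    (h.offDiagError_allMoments M₀ i j).pow 4
  have cs : ∀ ω, frobSq (offDiagError M₀ ε y p ω) ^ 2
      ≤ d ^ 2 * ∑ j, ∑ i, offDiagError M₀ ε y p ω i j ^ 4 := fun ω => by
    rw [frobSq_eq_sum, ← Fintype.sum_prod_type', ← Fintype.sum_prod_type']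
    have := sq_sum_le_card_mul_sum_sq (s := Finset.univ)
      (f := fun x : Fin d × Fin d => offDiagError M₀ ε y p ω x.2 x.1 ^ 2)
    simpa [← pow_mul, ← sq] using this
  calc ∫ ω, frobSq (offDiagError M₀ ε y p ω) ^ 2 ∂μ
      ≤ ∫ ω, d ^ 2 * ∑ j, ∑ i, offDiagError M₀ ε y p ω i j ^ 4 ∂μ :=
        integral_mono ((h.frobSq_offDiagError_allMoments M₀).pow 2).integrable
          ((AllMoments.const _).mul (AllMoments.sum _ fun j _ =>
            AllMoments.sum _ fun i _ => hm i j)).integrable cs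
    _ = d ^ 2 * ∑ j, ∑ i, ∫ ω, offDiagError M₀ ε y p ω i j ^ 4 ∂μ := by
        rw [integral_const_mul,
          integral_finsetSum _ fun j _ => (AllMoments.sum _ fun i _ => hm i j).integrable]
        simp_rw [integral_finsetSum _ fun i _ => (hm i _).integrable]
    _ ≤ d ^ 2 * ∑ _j : Fin d, ∑ _i : Fin d, 48 * n ^ 2 * fourthBound L K ^ 2 :=
        mul_le_mul_of_nonneg_left (Finset.sum_le_sum fun j _ => Finset.sum_le_sum fun i _ =>
          entry i j) (by positivity)
    _ = _ := by simp; ring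

end IsModel

end Error

/-! ### The expected distance between the singular subspaces -/

section Expectation

variable {Ω : Type*} {n d r m : ℕ}
  {ε y : Ω → Matrix (Fin n) (Fin d) ℝ} {σ : ℝ} {K : ℝ≥0} {p : ℝ}
  {M₀ : Matrix (Fin n) (Fin d) ℝ} {L : ℝ}

/-- Pathwise bound. When the error is too large for the perturbation bound, the distance is at most
`m`, and the indicator of that event is dominated by the square of the squared Frobenius norm for
the off-diagonal part and by the squared Frobenius norm for the diagonal part. -/
lemma sinDistSq_le_of_error {U : Matrix (Fin n) (Fin r) ℝ} {lam : Fin r → ℝ}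
    {V W : Matrix (Fin d) (Fin r) ℝ} (hS : IsSVD M₀ U lam V) (hp : 0 < p) (ω : Ω)
    (hW : IsTopEigenvectors (sigmaHat (observed M₀ (ε ω) (y ω)) (y ω)) W) (hm : m ≤ r)
    (h1 : 1 ≤ m) {a b : ℝ} (ha : ∀ i : Fin r, (i : ℕ) < m → a ≤ lam i ^ 2)
    (hb : ∀ i : Fin r, m ≤ (i : ℕ) → lam i ^ 2 ≤ b) (hb0 : 0 ≤ b) (hab : b < a) {g : ℝ}
    (hg : g = p ^ 2 * (a - b)) :
    sinDistSq (firstCols W m hm) (firstCols V m hm)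
      ≤ 32 / g ^ 2 * frobSq (offDiagError M₀ ε y p ω * firstCols V m hm)
        + 256 * m / g ^ 4 * frobSq (offDiagError M₀ ε y p ω) ^ 2
        + 48 * m / g ^ 2 * ∑ h, diagError M₀ ε y σ p h ω ^ 2 := by
  set G := offDiagError M₀ ε y p ω
  set E : Matrix (Fin d) (Fin d) ℝ := Matrix.diagonal fun h => diagError M₀ ε y σ p h ω with hE
  rw [← frobSq_diagonal, ← hE]
  have hg0 : 0 < g := by rw [hg]; exact mul_pos (by positivity) (sub_pos.2 hab)
  have hZ := firstCols_orthonormal hS.right_orthonormal hm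
  have hGE := frobSq_add_le G E
  have nG := frobSq_nonneg G
  have nE := frobSq_nonneg E
  have nGV := frobSq_nonneg (G * firstCols V m hm)
  have hm1 : (1 : ℝ) ≤ m := by exact_mod_cast h1
  by_cases hs : frobSq (G + E) ≤ (g / 2) ^ 2
  · have hD : sigmaHat (observed M₀ (ε ω) (y ω)) (y ω)
        = V * Matrix.diagonal (fun i => p ^ 2 * lam i ^ 2) * Vᵀ
          + (p ^ 2 * (n * σ ^ 2)) • 1 + (G + E) := by
      rw [sigmaHat_eq M₀ ε y σ p ω, hS.gram_eq, ← Matrix.smul_mul, ← Matrix.mul_smul,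
        ← Matrix.diagonal_smul]
      rfl
    have hp2 : 0 ≤ p ^ 2 := sq_nonneg p
    have key := hW.sinDistSq_le hS.right_orthonormal hm h1 (a := p ^ 2 * a) (b := p ^ 2 * b)
      (fun i hi => mul_le_mul_of_nonneg_left (ha i hi) hp2)
      (fun i hi => mul_le_mul_of_nonneg_left (hb i hi) hp2) (by positivity)
      (mul_lt_mul_of_pos_left hab (by positivity)) hD (by rw [← mul_sub, ← hg]; exact hs)
    rw [← mul_sub, ← hg] at key
    have hsplit : frobSq ((G + E) * firstCols V m hm)
        ≤ 2 * frobSq (G * firstCols V m hm) + 2 * (frobSq E * m) := by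
      rw [Matrix.add_mul]
      refine (frobSq_add_le _ _).trans ?_
      have := frobSq_mul_le E (firstCols V m hm)
      rw [frobSq_of_orthonormal hZ] at this
      linarith
    calc _ ≤ _ := key
      _ ≤ 16 * (2 * frobSq (G * firstCols V m hm) + 2 * (frobSq E * m)) / g ^ 2 := by gcongr
      _ = 32 / g ^ 2 * frobSq (G * firstCols V m hm) + 0 + 32 * m / g ^ 2 * frobSq E := by ring
      _ ≤ _ := by
        gcongr
        · positivity
        · norm_num
  · rw [not_le] at hs
    have hbig : (1 : ℝ) ≤ 256 / g ^ 4 * frobSq G ^ 2 + 16 / g ^ 2 * frobSq E := by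
      by_cases hG : g ^ 2 / 16 ≤ frobSq G
      · have : (1 : ℝ) ≤ 256 / g ^ 4 * frobSq G ^ 2 := by
          calc (1 : ℝ) = 256 / g ^ 4 * (g ^ 2 / 16) ^ 2 := by field_simp; norm_num
            _ ≤ _ := by gcongr
        have h2 : 0 ≤ 16 / g ^ 2 * frobSq E := by positivity
        linarith
      · have hE' : g ^ 2 / 16 ≤ frobSq E := by nlinarith
        have : (1 : ℝ) ≤ 16 / g ^ 2 * frobSq E := by
          calc (1 : ℝ) = 16 / g ^ 2 * (g ^ 2 / 16) := by field_simp
            _ ≤ _ := by gcongr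
        have h2 : 0 ≤ 256 / g ^ 4 * frobSq G ^ 2 := by positivity
        linarith
    calc _ ≤ (m : ℝ) := sinDistSq_le hZ (firstCols_orthonormal hW.orthonormal hm)
      _ = 0 + m * 1 := by ring
      -- `48` rather than `16` so that one constant serves both cases
      _ ≤ 32 / g ^ 2 * frobSq (G * firstCols V m hm)
          + m * (256 / g ^ 4 * frobSq G ^ 2 + 48 / g ^ 2 * frobSq E) := by
        gcongr
        · positivity
        · refine hbig.trans ?_
          gcongr
          norm_num
      _ = _ := by ring

variable [MeasurableSpace Ω] {μ : Measure Ω}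

lemma measurable_sinDistSq {W : Ω → Matrix (Fin d) (Fin r) ℝ}
    (hW : ∀ i j, Measurable fun ω => W ω i j) (hm : m ≤ r) (Z : Matrix (Fin d) (Fin m) ℝ) :
    Measurable fun ω => sinDistSq (firstCols (W ω) m hm) Z := by
  simp only [sinDistSq, frobSq_eq_sum, Matrix.mul_apply, Matrix.transpose_apply, firstCols,
    Matrix.submatrix_apply, id_eq]
  fun_prop

lemma integrable_sinDistSq [IsFiniteMeasure μ] {W : Ω → Matrix (Fin d) (Fin r) ℝ}
    (hWm : ∀ i j, Measurable fun ω => W ω i j) (hW : ∀ ω, (W ω)ᵀ * W ω = 1) (hm : m ≤ r)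
    {Z : Matrix (Fin d) (Fin m) ℝ} (hZ : Zᵀ * Z = 1) :
    Integrable (fun ω => sinDistSq (firstCols (W ω) m hm) Z) μ :=
  Integrable.of_bound (measurable_sinDistSq hWm hm Z).aestronglyMeasurable m <|
    ae_of_all _ fun ω => by
      rw [Real.norm_eq_abs, abs_of_nonneg (sinDistSq_nonneg _ _)]
      exact sinDistSq_le hZ (firstCols_orthonormal (hW ω) hm)

/-- The constant in the bound for the expected squared distance, per leading singular vector. -/
noncomputable def riskConst (L σ : ℝ) (K : ℝ≥0) : ℝ :=
  32 * ((L ^ 2 + σ ^ 2) * (2 * L ^ 2 + σ ^ 2)) + 12288 * fourthBound L K ^ 2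
    + 192 * fourthBound L K

/-- The bound for right singular vectors, without any relation between `n` and `d`. Left singular
vectors are covered by transposing. -/
lemma integral_sinDistSq_le [IsProbabilityMeasure μ] (h : IsModel μ ε y σ K p)
    {U : Matrix (Fin n) (Fin r) ℝ} {lam : Fin r → ℝ} {V : Matrix (Fin d) (Fin r) ℝ}
    (hS : IsSVD M₀ U lam V) (hL : ∀ k j, |M₀ k j| ≤ L) (hn : 0 < n) (hd : 0 < d) (hp : 0 < p)
    (hp1 : p ≤ 1) {W : Ω → Matrix (Fin d) (Fin r) ℝ} (hWm : ∀ i j, Measurable fun ω => W ω i j)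
    (hW : ∀ ω, IsTopEigenvectors (sigmaHat (observed M₀ (ε ω) (y ω)) (y ω)) (W ω)) (hm : m ≤ r)
    (h1 : 1 ≤ m) {a b β : ℝ} (ha : ∀ i : Fin r, (i : ℕ) < m → a ≤ lam i ^ 2)
    (hb : ∀ i : Fin r, m ≤ (i : ℕ) → lam i ^ 2 ≤ b) (hb0 : 0 ≤ b) (hβ : 0 < β)
    (hab : a - b = n * d * β) (hd3 : 1 ≤ p ^ 3 * d) (hn7 : 1 ≤ p ^ 7 * β ^ 2 * n) :
    ∫ ω, sinDistSq (firstCols (W ω) m hm) (firstCols V m hm) ∂μ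
      ≤ m * riskConst L σ K * (n : ℝ)⁻¹ / (p * β ^ 2) := by
  have hn' : (0 : ℝ) < n := by exact_mod_cast hn
  have hd' : (0 : ℝ) < d := by exact_mod_cast hd
  have hB := fourthBound_pos L K
  set B := fourthBound L K
  set g := p ^ 2 * (a - b) with hg
  set A := (L ^ 2 + σ ^ 2) * (2 * L ^ 2 + σ ^ 2) with hA
  have hgv : g = p ^ 2 * (n * d * β) := by rw [hg, hab]
  have hg0 : 0 < g := by rw [hgv]; positivity
  have hba : b < a := by
    have : 0 < a - b := by rw [hab]; positivity
    linarith
  have hZ := firstCols_orthonormal hS.right_orthonormal hm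
  have hpd : 1 ≤ p * d := by
    have : p ^ 3 ≤ p := by
      calc p ^ 3 = p * p ^ 2 := by ring
        _ ≤ p * 1 := by gcongr; exact pow_le_one₀ hp.le hp1
        _ = p := mul_one p
    exact hd3.trans (by gcongr)
  have m1 : AllMoments (fun ω => 32 / g ^ 2
      * frobSq (offDiagError M₀ ε y p ω * firstCols V m hm)) μ :=
    (AllMoments.const _).mul (h.frobSq_offDiagError_mul_allMoments M₀ _)
  have m2 : AllMoments (fun ω => 256 * m / g ^ 4 * frobSq (offDiagError M₀ ε y p ω) ^ 2) μ :=
    (AllMoments.const _).mul ((h.frobSq_offDiagError_allMoments M₀).pow 2)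
  have m3 : AllMoments (fun ω => 48 * m / g ^ 2 * ∑ j, diagError M₀ ε y σ p j ω ^ 2) μ :=
    (AllMoments.const _).mul (AllMoments.sum _ fun j _ => (h.diagError_allMoments M₀ j).pow 2)
  have i1 := h.integral_frobSq_offDiagError_mul_le hL hp.le hpd hZ
  have i2 := h.integral_frobSq_offDiagError_sq_le hL hp.le hp1
  have i3 : ∫ ω, ∑ j, diagError M₀ ε y σ p j ω ^ 2 ∂μ ≤ d * (4 * n * B) := by
    rw [integral_finsetSum _ fun j _ => ((h.diagError_allMoments M₀ j).pow 2).integrable]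
    refine (Finset.sum_le_sum fun j _ =>
      h.integral_diagError_sq_le hn hd hL hp.le hp1 j).trans (le_of_eq ?_)
    simp [B]
  have t1 : 32 / g ^ 2 * (m * (p ^ 3 * n * d ^ 2 * A))
      = m * (32 * A) * (n : ℝ)⁻¹ / (p * β ^ 2) := by
    rw [hgv]; field_simp
  have t2 : 256 * m / g ^ 4 * (48 * d ^ 4 * n ^ 2 * B ^ 2)
      ≤ m * (12288 * B ^ 2) * (n : ℝ)⁻¹ / (p * β ^ 2) := by
    have e : 256 * m / g ^ 4 * (48 * d ^ 4 * n ^ 2 * B ^ 2)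
        = m * (12288 * B ^ 2) * (n : ℝ)⁻¹ / (p * β ^ 2) * (1 / (p ^ 7 * β ^ 2 * n)) := by
      rw [hgv]; field_simp; norm_num
    rw [e]
    exact mul_le_of_le_one_right (by positivity)
      ((div_le_one (by linarith)).2 hn7)
  have t3 : 48 * m / g ^ 2 * (d * (4 * n * B)) ≤ m * (192 * B) * (n : ℝ)⁻¹ / (p * β ^ 2) := by
    have e : 48 * m / g ^ 2 * (d * (4 * n * B))
        = m * (192 * B) * (n : ℝ)⁻¹ / (p * β ^ 2) * (1 / (p ^ 3 * d)) := by
      rw [hgv]; field_simp; norm_num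
    rw [e]
    exact mul_le_of_le_one_right (by positivity)
      ((div_le_one (by linarith)).2 hd3)
  calc ∫ ω, sinDistSq (firstCols (W ω) m hm) (firstCols V m hm) ∂μ
      ≤ ∫ ω, (32 / g ^ 2 * frobSq (offDiagError M₀ ε y p ω * firstCols V m hm)
        + 256 * m / g ^ 4 * frobSq (offDiagError M₀ ε y p ω) ^ 2
        + 48 * m / g ^ 2 * ∑ j, diagError M₀ ε y σ p j ω ^ 2) ∂μ :=
        integral_mono (integrable_sinDistSq hWm (fun ω => (hW ω).orthonormal) hm hZ)
          ((m1.add m2).add m3).integrable fun ω =>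
            sinDistSq_le_of_error hS hp ω (hW ω) hm h1 ha hb hb0 hba hg
    _ = 32 / g ^ 2 * ∫ ω, frobSq (offDiagError M₀ ε y p ω * firstCols V m hm) ∂μ
        + 256 * m / g ^ 4 * ∫ ω, frobSq (offDiagError M₀ ε y p ω) ^ 2 ∂μ
        + 48 * m / g ^ 2 * ∫ ω, ∑ j, diagError M₀ ε y σ p j ω ^ 2 ∂μ := by
        rw [integral_add (m1.add m2).integrable m3.integrable,
          integral_add m1.integrable m2.integrable, integral_const_mul, integral_const_mul,
          integral_const_mul]
    _ ≤ 32 / g ^ 2 * (m * (p ^ 3 * n * d ^ 2 * A))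
        + 256 * m / g ^ 4 * (48 * d ^ 4 * n ^ 2 * B ^ 2)
        + 48 * m / g ^ 2 * (d * (4 * n * B)) := by gcongr
    _ ≤ m * (32 * A) * (n : ℝ)⁻¹ / (p * β ^ 2) + m * (12288 * B ^ 2) * (n : ℝ)⁻¹ / (p * β ^ 2)
        + m * (192 * B) * (n : ℝ)⁻¹ / (p * β ^ 2) := by
        rw [t1]; gcongr
    _ = _ := by rw [riskConst]; ring

end Expectation

/-! ### Uniform bounds under the gap assumption -/

lemma riskConst_pos (L σ : ℝ) (K : ℝ≥0) : 0 < riskConst L σ K := by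
  have := fourthBound_pos L K
  unfold riskConst; positivity

lemma phat_transpose {n d : ℕ} (y : Matrix (Fin n) (Fin d) ℝ) : phat yᵀ = phat y := by
  simp only [phat, Matrix.transpose_apply]
  rw [Finset.sum_comm, mul_comm]

/-- The two Gram matrices are exchanged by transposing the data. -/
lemma sigmaHatT_observed {n d : ℕ} (M₀ ε y : Matrix (Fin n) (Fin d) ℝ) :
    sigmaHatT (observed M₀ ε y) y = sigmaHat (observed M₀ᵀ εᵀ yᵀ) yᵀ := by
  rw [sigmaHat, phat_transpose]
  rfl

/-- The rank is bounded because each singular value takes a fixed share of the Frobenius norm. -/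
lemma rank_le {n d r : ℕ} {M₀ : Matrix (Fin n) (Fin d) ℝ} {U : Matrix (Fin n) (Fin r) ℝ}
    {lam : Fin r → ℝ} {V : Matrix (Fin d) (Fin r) ℝ} {L c : ℝ} {b : ℕ → ℝ}
    (hS : IsSVD M₀ U lam V) (hL : ∀ k j, |M₀ k j| ≤ L) (hn : 0 < n) (hd : 0 < d) (hc : 0 < c)
    (hlam : ∀ i : Fin r, lam i ^ 2 = b (i + 1) ^ 2 * (n * d))
    (hb : ∀ i, 1 ≤ i → i ≤ r → 1 / c ≤ b i) : (r : ℝ) ≤ c ^ 2 * L ^ 2 := by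
  have hnd : (0 : ℝ) < n * d := by positivity
  have h1 : ∑ _i : Fin r, (1 / c) ^ 2 * ((n : ℝ) * d) ≤ n * d * L ^ 2 := by
    refine (Finset.sum_le_sum fun i _ => ?_).trans (hS.sum_sq_le hL)
    rw [hlam]
    have := hb (i + 1) (by omega) (by omega)
    gcongr
  rw [Finset.sum_const, Finset.card_univ, Fintype.card_fin, nsmul_eq_mul] at h1
  have h2 : (r : ℝ) * (1 / c) ^ 2 ≤ L ^ 2 := by
    refine le_of_mul_le_mul_right ?_ hnd
    linarith
  calc (r : ℝ) = c ^ 2 * (r * (1 / c) ^ 2) := by field_simp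
    _ ≤ c ^ 2 * L ^ 2 := by gcongr

/-- The bound for right singular vectors under the eigen-gap assumption. -/
lemma risk_bound {n d r m : ℕ} {p L c σ p₀ δ : ℝ} {K : ℝ≥0} {b : ℕ → ℝ}
    {M₀ : Matrix (Fin n) (Fin d) ℝ} {U : Matrix (Fin n) (Fin r) ℝ} {lam : Fin r → ℝ}
    {V : Matrix (Fin d) (Fin r) ℝ} {Ω : Type*} [MeasurableSpace Ω] {μ : Measure Ω}
    [IsProbabilityMeasure μ] {ε y : Ω → Matrix (Fin n) (Fin d) ℝ}
    {W : Ω → Matrix (Fin d) (Fin r) ℝ} (hm : m ≤ r) (h1 : 1 ≤ m) (hc : 0 < c) (hδ : 0 < δ)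
    (hp₀ : 0 < p₀) (hn : 0 < n) (hd : 0 < d) (hd3 : 1 ≤ p₀ ^ 3 * d)
    (hn7 : 1 ≤ p₀ ^ 7 * δ ^ 4 * n) (hp : p₀ ≤ p) (hp1 : p ≤ 1) (hS : IsSVD M₀ U lam V)
    (hL : ∀ k j, |M₀ k j| ≤ L) (hlam : ∀ i : Fin r, lam i ^ 2 = b (i + 1) ^ 2 * (n * d))
    (hb : ∀ i, 1 ≤ i → i ≤ r → 1 / c ≤ b i) (hbr : b (r + 1) = 0) (hgap : δ ≤ b m - b (m + 1))
    (h : IsModel μ ε y σ K p) (hWm : ∀ i j, Measurable fun ω => W ω i j)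
    (hW : ∀ ω, IsTopEigenvectors (sigmaHat (observed M₀ (ε ω) (y ω)) (y ω)) (W ω)) :
    Integrable (fun ω => sinDistSq (firstCols (W ω) m hm) (firstCols V m hm)) μ ∧
      ∫ ω, sinDistSq (firstCols (W ω) m hm) (firstCols V m hm) ∂μ
        ≤ c ^ 2 * L ^ 2 * riskConst L σ K * (n : ℝ)⁻¹ / (p * (b m ^ 2 - b (m + 1) ^ 2) ^ 2) := by
  refine ⟨integrable_sinDistSq hWm (fun ω => (hW ω).orthonormal) hm
    (firstCols_orthonormal hS.right_orthonormal hm), ?_⟩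
  have hp0 : 0 < p := hp₀.trans_le hp
  have hnext : 0 ≤ b (m + 1) := by
    rcases hm.lt_or_eq with hlt | rfl
    · exact (by positivity : 0 ≤ 1 / c).trans (hb _ (by omega) (by omega))
    · exact hbr.ge
  have hβ : δ ^ 2 ≤ b m ^ 2 - b (m + 1) ^ 2 := by nlinarith
  have hβ0 : 0 < b m ^ 2 - b (m + 1) ^ 2 := (by positivity : 0 < δ ^ 2).trans_le hβ
  have hsq : ∀ i j : Fin r, i ≤ j → lam j ^ 2 ≤ lam i ^ 2 := fun i j hij =>
    pow_le_pow_left₀ (hS.pos j).le (hS.antitone hij) 2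
  have hR := rank_le hS hL hn hd hc hlam hb
  have hmr : (m : ℝ) ≤ c ^ 2 * L ^ 2 := (Nat.cast_le.2 hm).trans hR
  have hpos := riskConst_pos L σ K
  refine (integral_sinDistSq_le h hS hL hn hd hp0 hp1 hWm hW hm h1
    (a := b m ^ 2 * (n * d)) (b := b (m + 1) ^ 2 * (n * d))
    (β := b m ^ 2 - b (m + 1) ^ 2) (fun i hi => ?_) (fun i hi => ?_) (by positivity) hβ0 (by ring)
    ?_ ?_).trans ?_
  · have := hsq i ⟨m - 1, by omega⟩ (Fin.mk_le_mk.2 (by omega))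
    rw [hlam ⟨m - 1, _⟩] at this
    simpa only [Nat.sub_add_cancel h1] using this
  · have := hsq ⟨m, by omega⟩ i (Fin.mk_le_mk.2 hi)
    rwa [hlam ⟨m, _⟩] at this
  · exact hd3.trans (by gcongr)
  · calc 1 ≤ p₀ ^ 7 * δ ^ 4 * n := hn7
      _ = p₀ ^ 7 * (δ ^ 2) ^ 2 * n := by ring
      _ ≤ _ := by gcongr
  · gcongr

end PartialObs

theorem theorem1 (α L c σ : ℝ) (K : ℝ≥0) (hα : α < 1) (hL : 0 < L) (hc : 0 < c) :
    ∃ C₁ C₂ : ℝ, 0 < C₁ ∧ 0 < C₂ ∧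
      ∀ p₀ δ : ℝ, 0 < p₀ → 0 < δ → ∃ N : ℕ,
        ∀ (n d r m : ℕ) (p : ℝ) (b : ℕ → ℝ)
          (M₀ : Matrix (Fin n) (Fin d) ℝ)
          (U : Matrix (Fin n) (Fin r) ℝ) (V : Matrix (Fin d) (Fin r) ℝ)
          (Ω : Type*) [MeasurableSpace Ω] (μ : Measure Ω) [IsProbabilityMeasure μ]
          (ε y : Ω → Matrix (Fin n) (Fin d) ℝ)
          (Vhat : Ω → Matrix (Fin d) (Fin r) ℝ) (Uhat : Ω → Matrix (Fin n) (Fin r) ℝ)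
          (hm : m ≤ r),
          1 ≤ m →
          -- large `n` and `d`
          N ≤ n → N ≤ d → d ≤ n → (n : ℝ) ≤ Real.exp ((d : ℝ) ^ α) →
          p₀ ≤ p → p ≤ 1 →
          -- the underlying matrix, with singular values `lam i = b i * √(n d)` (1-indexed)
          PartialObs.IsSVD M₀ U
            (fun i : Fin r => b ((i : ℕ) + 1) * Real.sqrt ((n : ℝ) * (d : ℝ))) V →
          (∀ k h, |M₀ k h| ≤ L) →
          (∀ i, 1 ≤ i → i ≤ r → 1 / c ≤ b i ∧ b i ≤ c) →
          b (r + 1) = 0 →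
          -- the eigen-gap at `m`
          δ ≤ b m - b (m + 1) →
          -- noise and sampling
          PartialObs.IsModel μ ε y σ K p →
          -- the estimators
          (∀ i j, Measurable (fun ω => Vhat ω i j)) →
          (∀ i j, Measurable (fun ω => Uhat ω i j)) →
          (∀ ω, PartialObs.IsTopEigenvectors
            (PartialObs.sigmaHat (PartialObs.observed M₀ (ε ω) (y ω)) (y ω)) (Vhat ω)) →
          (∀ ω, PartialObs.IsTopEigenvectors
            (PartialObs.sigmaHatT (PartialObs.observed M₀ (ε ω) (y ω)) (y ω)) (Uhat ω)) →
          (Integrable (fun ω => PartialObs.sinDistSq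
              (PartialObs.firstCols (Vhat ω) m hm) (PartialObs.firstCols V m hm)) μ ∧
            ∫ ω, PartialObs.sinDistSq
              (PartialObs.firstCols (Vhat ω) m hm) (PartialObs.firstCols V m hm) ∂μ
              ≤ C₁ * (n : ℝ)⁻¹ / (p * (b m ^ 2 - b (m + 1) ^ 2) ^ 2)) ∧
          (Integrable (fun ω => PartialObs.sinDistSq
              (PartialObs.firstCols (Uhat ω) m hm) (PartialObs.firstCols U m hm)) μ ∧
            ∫ ω, PartialObs.sinDistSq
              (PartialObs.firstCols (Uhat ω) m hm) (PartialObs.firstCols U m hm) ∂μ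
              ≤ C₂ * (d : ℝ)⁻¹ / (p * (b m ^ 2 - b (m + 1) ^ 2) ^ 2)) := by
  have hC : 0 < c ^ 2 * L ^ 2 * PartialObs.riskConst L σ K := by
    have := PartialObs.riskConst_pos L σ K
    positivity
  refine ⟨_, _, hC, hC, fun p₀ δ hp₀ hδ => ?_⟩
  obtain ⟨N₁, hN₁⟩ := exists_nat_ge (1 / p₀ ^ 3)
  obtain ⟨N₂, hN₂⟩ := exists_nat_ge (1 / (p₀ ^ 7 * δ ^ 4))
  refine ⟨max 1 (max N₁ N₂), ?_⟩
  intro n d r m p b M₀ U V Ω _ μ _ ε y Vhat Uhat hm h1 hNn hNd _ _ hp hp1 hS hL hb hbr hgap h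
    hVm hUm hV hU
  have big : ∀ k : ℕ, max 1 (max N₁ N₂) ≤ k →
      0 < k ∧ 1 ≤ p₀ ^ 3 * k ∧ 1 ≤ p₀ ^ 7 * δ ^ 4 * k := fun k hk => by
    have hk' := (le_max_right _ _).trans hk
    have e1 : (N₁ : ℝ) ≤ k := by exact_mod_cast (le_max_left N₁ N₂).trans hk'
    have e2 : (N₂ : ℝ) ≤ k := by exact_mod_cast (le_max_right N₁ N₂).trans hk'
    refine ⟨(le_max_left _ _).trans hk, ?_, ?_⟩
    · rw [← div_le_iff₀' (by positivity)]
      exact hN₁.trans e1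
    · rw [← div_le_iff₀' (by positivity)]
      exact hN₂.trans e2
  obtain ⟨hn, hn3, hn7⟩ := big n hNn
  obtain ⟨hd, hd3, hd7⟩ := big d hNd
  have hlam : ∀ i : Fin r, (b ((i : ℕ) + 1) * Real.sqrt ((n : ℝ) * (d : ℝ))) ^ 2
      = b (i + 1) ^ 2 * (n * d) := fun i => by
    rw [mul_pow, Real.sq_sqrt (by positivity)]
  refine ⟨PartialObs.risk_bound hm h1 hc hδ hp₀ hn hd hd3 hn7 hp hp1 hS hL hlam
    (fun i h1 h2 => (hb i h1 h2).1) hbr hgap h hVm hV,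
    PartialObs.risk_bound hm h1 hc hδ hp₀ hd hn hn3 hd7 hp hp1 hS.transpose (fun k j => hL j k)
      (fun i => by rw [hlam, mul_comm (n : ℝ)]) (fun i h1 h2 => (hb i h1 h2).1) hbr hgap
      h.transpose hUm fun ω => ?_⟩
  rw [← PartialObs.sigmaHatT_observed]
  exact hU ω
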